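/- Let $\mathbb F$ be a division ring, $\sigma$ an automorphism of $\mathbb F$, and $\delta$ a $\sigma$-derivation of $\mathbb F$ (an additive map with $\delta(ab)=\sigma(a)\delta(b)+\delta(a)b$). Let $\mathcal R=\mathbb F[x;\sigma,\delta]$ be the skew polynomial ring, whose elements are the polynomials $\sum_i a_ix^i$ with left coefficients and whose product is determined by $xa=\sigma(a)x+\delta(a)$. For $f\in\mathcal R$ and $b\in\mathbb F$, the right evaluation $f(b)\in\mathbb F$ (left evaluation $f_L(b)\in\mathbb F$) is the remainder upon right (left) division of $f$ by $x-b$, i.e. $f=q\,(x-b)+f(b)$ (respectively $f=(x-b)\,q+f_L(b)$); $b$ is a right (left) root of $f$ if $f(b)=0$ ($f_L(b)=0$). For a finite sequence $\mathbf a=(a_1,\dots,a_r)$ in $\mathbb F$ put $P_{\mathbf a}=(x-a_r)\cdots(x-a_2)(x-a_1)$ and $P_{\mathbf a,L}=(x-a_1)(x-a_2)\cdots(x-a_r)$ (both are $1$ for the empty sequence). Let $\Delta_{\mathbf a}f$ be the quotient upon right division of $f$ by $P_{\mathbf a}$ (that is, $f=\Delta_{\mathbf a}f\cdot P_{\mathbf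 a}+\rho$ with $\deg\rho<r$), and $\Delta_{\mathbf a,L}f$ the quotient upon left division of $f$ by $P_{\mathbf a,L}$ (that is, $f=P_{\mathbf a,L}\cdot\Delta_{\mathbf a,L}f+\rho$ with $\deg\rho<r$). For $0\le i\le r$ write $\mathbf a_i=(a_1,\dots,a_i)$; in particular $\Delta_{\mathbf a_0}f=\Delta_{\mathbf a_0,L}f=f$. For $r\ge1$ the sequence $\mathbf a$ is a right (left) $(\sigma,\delta)$-multiplicity sequence if $a_1$ is the only right root of $P_{\mathbf a}$ (the only left root of $P_{\mathbf a,L}$). In that case $a_1$ is called a right (left) root of $f$ of multiplicity $r$ via $\mathbf a$ if $f\in\mathcal R\,P_{\mathbf a}$ (respectively $f\in P_{\mathbf a,L}\,\mathcal R$). Let $f,g\in\mathcal R$ have degrees $m,n\ge 0$. The right resultant $R(f,g)$ is the Dieudonné determinant, with values in $\{0\}\cup\mathbb F^*/[\mathbb F^*,\mathbb F^*]$, of the $(m+n)\times(m+n)$ matrix $A$ whose rows are the left-hand coefficients of $1,x,\dots,x^{m+n-1}$ in $f,xf,\dots,x^{n-1}f,g,xg,\dots,x^{m-1}g$; it is the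 matrix of the system $(c_0,\dots,c_{n-1},d_0,\dots,d_{m-1})A=0$ expressing $cf+dg=0$ for $c=\sum_i c_ix^i$, $d=\sum_i d_ix^i$. Explicitly, for $0\le q<m+n$, the row of $x^pf$ ($f=\sum_i a_ix^i$) has entry $\sum_{l=0}^{p}\mathcal C_{p-l,l}(a_{q-l})$ in the column of $x^q$, where $a_t=0$ for $t<0$ or $t>m$, and $\mathcal C_{d,s}$ is the sum of all compositions of $d$ copies of $\delta$ and $s$ copies of $\sigma$; similarly for $g$. The left resultant $R_L(f,g)$ is the Dieudonné determinant of the $(m+n)\times(m+n)$ matrix $M$ whose columns are the right-hand coefficients (those in $\sum_q x^q\mathcal A_q$) of $f,fx,\dots,fx^{n-1},g,gx,\dots,gx^{m-1}$; it is the matrix of the system $M\,(C_0,\dots,C_{n-1},D_0,\dots,D_{m-1})^T=0$ expressing $fc+gd=0$ for $c=\sum_i x^iC_i$, $d=\sum_i x^iD_i$. Explicitly, the column of $fx^p$ has entry $\sum_{l=0}^{p}(-1)^{p-l}\mathcal T_{p-l,l}(\mathcal A_{q-l})$ in the row of $x^q$, where $\mathcal A_i=\sum_{j=0}^{m-i}(-1)^j\mathcal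 T_{j,i}(a_{j+i})$ for $0\le i\le m$ and $\mathcal A_i=0$ otherwise, and $\mathcal T_{d,s}$ is the sum of all compositions of $d$ copies of $\delta\sigma^{-1}$ and $s$ copies of $\sigma^{-1}$; similarly for $g$. Finally, $\mathrm{gcrd}(f,g)$ and $\mathrm{gcld}(f,g)$ denote the monic greatest common right and left divisors of $f$ and $g$. **Theorem.** Let $f\in\mathcal R$, let $r$ be a positive integer with $r<\deg f$, and let $\mathbf a=(a_1,\dots,a_r)\in\mathbb F^r$. (Right case) If $\mathbf a$ is a right $(\sigma,\delta)$-multiplicity sequence, then the following are equivalent: 1. $a_1$ is a right root of $f$ of multiplicity $r$ via $\mathbf a$; 2. $(\Delta_{\mathbf a_i}f)(a_{i+1})=0$ for all $i=0,1,\dots,r-1$; 3. $R_L(\Delta_{\mathbf a_i}f,\Delta_{\mathbf a_{i+1}}f)=0$ for all $i=0,1,\dots,r-1$; 4. $\mathrm{gcld}(\Delta_{\mathbf a_i}f,\Delta_{\mathbf a_{i+1}}f)\neq1$ for all $i=0,1,\dots,r-1$. (Left case) If $\mathbf a$ is a left $(\sigma,\delta)$-multiplicity sequence, then the following are equivalent: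 1. $a_1$ is a left root of $f$ of multiplicity $r$ via $\mathbf a$; 2. $(\Delta_{\mathbf a_i,L}f)_L(a_{i+1})=0$ for all $i=0,1,\dots,r-1$; 3. $R(\Delta_{\mathbf a_i,L}f,\Delta_{\mathbf a_{i+1},L}f)=0$ for all $i=0,1,\dots,r-1$; 4. $\mathrm{gcrd}(\Delta_{\mathbf a_i,L}f,\Delta_{\mathbf a_{i+1},L}f)\neq1$ for all $i=0,1,\dots,r-1$. -/

import Mathlib

open Polynomial

universe u

section OreExtension

variable {F : Type u} [DivisionRing F]

/-- A `σ`-derivation of `F`: an additive map `δ` with `δ (a b) = σ a * δ b + δ a * b`. -/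
structure SkewDerivation (σ : F ≃+* F) where
  toFun : F →+ F
  leibniz' : ∀ a b : F, toFun (a * b) = σ a * toFun b + toFun a * b

instance (σ : F ≃+* F) : CoeFun (SkewDerivation σ) (fun _ => F → F) := ⟨fun δ => δ.toFun⟩

variable {σ : F ≃+* F}

/-- The skew polynomial ring `F[x;σ,δ]`. Its elements are the polynomials `∑ aᵢ xⁱ` with
coefficients on the left, so the underlying left `F`-module is that of `F[X]`; the product is a
different one and is defined below from the rule `x a = σ a x + δ a`. -/
def SkewPoly (_δ : SkewDerivation σ) : Type u := F[X]

namespace SkewPoly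

variable {δ : SkewDerivation σ}

noncomputable instance : AddCommGroup (SkewPoly δ) := inferInstanceAs (AddCommGroup F[X])

noncomputable instance : Module F (SkewPoly δ) := inferInstanceAs (Module F F[X])

/-- The coefficient `aₙ` of `f = ∑ aᵢ xⁱ`. -/
noncomputable def coeff (f : SkewPoly δ) (n : ℕ) : F := Polynomial.coeff (R := F) f n

/-- The degree of a skew polynomial, with `degree 0 = ⊥`. -/
noncomputable def degree (f : SkewPoly δ) : WithBot ℕ := Polynomial.degree (R := F) f

/-- The degree of a skew polynomial as a natural number, with `natDegree 0 = 0`. -/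
noncomputable def natDegree (f : SkewPoly δ) : ℕ := Polynomial.natDegree (R := F) f

/-- The skew monomial `a xⁿ`. -/
noncomputable def mono (δ : SkewDerivation σ) (n : ℕ) : F →+ SkewPoly δ :=
  (Polynomial.monomial (R := F) n).toAddMonoidHom

/-- Left multiplication by `x`:
`x * ∑ bⱼ xʲ = ∑ (σ bⱼ xʲ⁺¹ + δ bⱼ xʲ)`. -/
noncomputable def xMul (δ : SkewDerivation σ) (g : SkewPoly δ) : SkewPoly δ :=
  Polynomial.sum (R := F) g fun j b => mono δ (j + 1) (σ b) + mono δ j (δ b)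

/-- The product: `(∑ aᵢ xⁱ) * g = ∑ aᵢ (x * (x * ⋯ (x * g)))`. -/
noncomputable instance : Mul (SkewPoly δ) :=
  ⟨fun f g => Polynomial.sum (R := F) f fun i a => a • (xMul δ)^[i] g⟩

noncomputable instance : One (SkewPoly δ) := ⟨mono δ 0 1⟩

theorem mul_def (f g : SkewPoly δ) :
    f * g = Polynomial.sum (R := F) f fun i a => a • (xMul δ)^[i] g := rfl

theorem one_def : (1 : SkewPoly δ) = mono δ 0 1 := rfl

theorem ext' {f g : SkewPoly δ} (h : ∀ n, f.coeff n = g.coeff n) : f = g :=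
  Polynomial.ext (R := F) h

@[simp] theorem coeff_add (f g : SkewPoly δ) (n : ℕ) : (f + g).coeff n = f.coeff n + g.coeff n :=
  Polynomial.coeff_add (R := F) f g n

@[simp] theorem coeff_sub (f g : SkewPoly δ) (n : ℕ) : (f - g).coeff n = f.coeff n - g.coeff n :=
  Polynomial.coeff_sub (R := F) f g n

@[simp] theorem coeff_zero (n : ℕ) : (0 : SkewPoly δ).coeff n = 0 :=
  Polynomial.coeff_zero (R := F) n

@[simp] theorem coeff_smul (a : F) (f : SkewPoly δ) (n : ℕ) : (a • f).coeff n = a * f.coeff n :=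
  Polynomial.coeff_smul (R := F) a f n

theorem coeff_mono (n : ℕ) (a : F) (k : ℕ) :
    (mono δ n a).coeff k = if n = k then a else 0 :=
  Polynomial.coeff_monomial (R := F)

theorem induction {p : SkewPoly δ → Prop} (f : SkewPoly δ)
    (hadd : ∀ f g, p f → p g → p (f + g)) (hmono : ∀ n a, p (mono δ n a)) : p f :=
  Polynomial.induction_on' (R := F) f hadd hmono

theorem smul_mono (a : F) (n : ℕ) (b : F) : a • mono δ n b = mono δ n (a * b) :=
  Polynomial.smul_monomial (R := F) a n b

theorem delta_zero : δ (0 : F) = 0 := map_zero δ.toFun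

theorem delta_one : δ (1 : F) = 0 := by
  have h := δ.leibniz' 1 1
  simpa using h

theorem xMul_mono (n : ℕ) (b : F) :
    xMul δ (mono δ n b) = mono δ (n + 1) (σ b) + mono δ n (δ b) := by
  refine (Polynomial.sum_monomial_index (R := F) b _ ?_)
  simp

theorem xMul_add (f g : SkewPoly δ) : xMul δ (f + g) = xMul δ f + xMul δ g := by
  refine Polynomial.sum_add_index (R := F) f g _ ?_ ?_
  · intro i
    simp
  · intro i a b
    simp only [map_add]
    abel

theorem xMul_smul (a : F) (f : SkewPoly δ) : xMul δ (a • f) = σ a • xMul δ f + δ a • f := by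
  induction f using SkewPoly.induction with
  | hadd f g hf hg =>
    rw [smul_add, xMul_add, hf, hg, xMul_add, smul_add, smul_add]
    abel
  | hmono n b =>
    rw [smul_mono, xMul_mono, xMul_mono, smul_add, smul_mono, smul_mono, smul_mono,
      δ.leibniz', map_mul, map_add]
    abel

theorem xMul_iterate_add (i : ℕ) (f g : SkewPoly δ) :
    (xMul δ)^[i] (f + g) = (xMul δ)^[i] f + (xMul δ)^[i] g := by
  induction i with
  | zero => rfl
  | succ i ih => simp only [Function.iterate_succ_apply', ih, xMul_add]

theorem mono_mul (n : ℕ) (a : F) (g : SkewPoly δ) : mono δ n a * g = a • (xMul δ)^[n] g := by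
  rw [mul_def]
  refine (Polynomial.sum_monomial_index (R := F) a _ ?_)
  simp

protected theorem add_mul' (f g h : SkewPoly δ) : (f + g) * h = f * h + g * h := by
  simp only [mul_def]
  refine Polynomial.sum_add_index (R := F) f g _ ?_ ?_
  · intro i
    simp
  · intro i a b
    rw [add_smul]

protected theorem mul_add' (f g h : SkewPoly δ) : f * (g + h) = f * g + f * h := by
  induction f using SkewPoly.induction with
  | hadd p q hp hq =>
    simp only [SkewPoly.add_mul', hp, hq]
    abel
  | hmono n a => simp only [mono_mul, xMul_iterate_add, smul_add]

protected theorem smul_mul' (a : F) (f g : SkewPoly δ) : (a • f) * g = a • (f * g) := by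
  induction f using SkewPoly.induction with
  | hadd p q hp hq => simp only [SkewPoly.add_mul', smul_add, hp, hq]
  | hmono n b => rw [smul_mono, mono_mul, mono_mul, mul_smul]

theorem xMul_mul (f g : SkewPoly δ) : xMul δ f * g = xMul δ (f * g) := by
  induction f using SkewPoly.induction with
  | hadd p q hp hq => simp only [SkewPoly.add_mul', xMul_add, hp, hq]
  | hmono n b =>
    rw [xMul_mono, SkewPoly.add_mul', mono_mul, mono_mul, mono_mul, xMul_smul,
      Function.iterate_succ_apply']

protected theorem mul_assoc' (f g h : SkewPoly δ) : f * g * h = f * (g * h) := by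
  induction f using SkewPoly.induction with
  | hadd p q hp hq => simp only [SkewPoly.add_mul', hp, hq]
  | hmono n a =>
    rw [mono_mul, mono_mul, SkewPoly.smul_mul']
    congr 1
    induction n with
    | zero => rfl
    | succ n ih => rw [Function.iterate_succ_apply', Function.iterate_succ_apply', xMul_mul, ih]

protected theorem one_mul' (f : SkewPoly δ) : 1 * f = f := by
  rw [one_def, mono_mul, one_smul]
  rfl

theorem xMul_iterate_one (n : ℕ) : (xMul δ)^[n] (1 : SkewPoly δ) = mono δ n 1 := by
  induction n with
  | zero => rfl
  | succ n ih =>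
    rw [Function.iterate_succ_apply', ih, xMul_mono, map_one, delta_one, map_zero, add_zero]

protected theorem mul_one' (f : SkewPoly δ) : f * 1 = f := by
  induction f using SkewPoly.induction with
  | hadd p q hp hq => rw [SkewPoly.add_mul', hp, hq]
  | hmono n a => rw [mono_mul, xMul_iterate_one, smul_mono, mul_one]

protected theorem zero_mul' (f : SkewPoly δ) : 0 * f = 0 := by
  have h := SkewPoly.add_mul' 0 0 f
  simpa using h

protected theorem mul_zero' (f : SkewPoly δ) : f * 0 = 0 := by
  have h := SkewPoly.mul_add' f 0 0
  simpa using h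

noncomputable instance : Ring (SkewPoly δ) :=
  { (inferInstance : AddCommGroup (SkewPoly δ)) with
    mul := (· * ·)
    one := 1
    left_distrib := SkewPoly.mul_add'
    right_distrib := SkewPoly.add_mul'
    zero_mul := SkewPoly.zero_mul'
    mul_zero := SkewPoly.mul_zero'
    mul_assoc := SkewPoly.mul_assoc'
    one_mul := SkewPoly.one_mul'
    mul_one := SkewPoly.mul_one' }

/-- The constant skew polynomial `a`. -/
noncomputable def C (δ : SkewDerivation σ) (a : F) : SkewPoly δ := mono δ 0 a

/-- The variable `x`. -/
noncomputable def X (δ : SkewDerivation σ) : SkewPoly δ := mono δ 1 1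

/-- The defining relation of `F[x;σ,δ]`. -/
theorem X_mul_C (a : F) : X δ * C δ a = C δ (σ a) * X δ + C δ (δ a) := by
  simp only [X, C, mono_mul, one_smul, Function.iterate_one, Function.iterate_zero, id, xMul_mono,
    smul_mono, mul_one]

/-! ### Division -/

theorem natDegree_le_iff {f : SkewPoly δ} {n : ℕ} :
    f.natDegree ≤ n ↔ ∀ k, n < k → f.coeff k = 0 :=
  Polynomial.natDegree_le_iff_coeff_eq_zero (p := (f : F[X]))

theorem degree_lt_iff {f : SkewPoly δ} {n : ℕ} :
    f.degree < n ↔ ∀ k, n ≤ k → f.coeff k = 0 :=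
  Polynomial.degree_lt_iff_coeff_zero (f : F[X]) n

theorem coeff_natDegree_ne_zero {f : SkewPoly δ} (hf : f ≠ 0) : f.coeff f.natDegree ≠ 0 :=
  (Polynomial.leadingCoeff_ne_zero (p := (f : F[X]))).2 hf

theorem degree_eq_natDegree {f : SkewPoly δ} (hf : f ≠ 0) : f.degree = f.natDegree :=
  Polynomial.degree_eq_natDegree (p := (f : F[X])) hf

theorem coeff_xMul_succ (g : SkewPoly δ) (n : ℕ) :
    (xMul δ g).coeff (n + 1) = σ (g.coeff n) + δ (g.coeff (n + 1)) := by
  induction g using SkewPoly.induction with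
  | hadd p q hp hq =>
    simp only [xMul_add, coeff_add, hp, hq, map_add]
    abel
  | hmono k b =>
    rw [xMul_mono, coeff_add, coeff_mono, coeff_mono, coeff_mono, coeff_mono]
    congr 1 <;> split_ifs <;> simp_all

theorem coeff_iterate_xMul (i : ℕ) {g : SkewPoly δ} {n : ℕ} (hg : ∀ k, n < k → g.coeff k = 0) :
    (∀ k, i + n < k → ((xMul δ)^[i] g).coeff k = 0) ∧
      ((xMul δ)^[i] g).coeff (i + n) = (σ : F → F)^[i] (g.coeff n) := by
  induction i with
  | zero => simpa using hg
  | succ i ih =>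
    refine ⟨fun k hk => ?_, ?_⟩
    · obtain ⟨k, rfl⟩ : ∃ j, k = j + 1 := ⟨k - 1, by omega⟩
      rw [Function.iterate_succ_apply', coeff_xMul_succ, ih.1 k (by omega),
        ih.1 (k + 1) (by omega)]
      simp
    · rw [show i + 1 + n = (i + n) + 1 by omega, Function.iterate_succ_apply', coeff_xMul_succ,
        ih.2, ih.1 (i + n + 1) (by omega), Function.iterate_succ_apply']
      simp

theorem coeff_mul_top {f g : SkewPoly δ} {m n : ℕ} (hf : ∀ k, m < k → f.coeff k = 0)
    (hg : ∀ k, n < k → g.coeff k = 0) :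
    (∀ k, m + n < k → (f * g).coeff k = 0) ∧
      (f * g).coeff (m + n) = f.coeff m * (σ : F → F)^[m] (g.coeff n) := by
  have key : ∀ k, (f * g).coeff k =
      ∑ i ∈ Finset.range (m + 1), f.coeff i * ((xMul δ)^[i] g).coeff k := by
    intro k
    have h1 : f * g = ∑ i ∈ Finset.range (m + 1), f.coeff i • (xMul δ)^[i] g := by
      rw [mul_def]
      refine Polynomial.sum_over_range' (R := F) f (by simp) _ ?_
      exact Nat.lt_succ_of_le (natDegree_le_iff.2 hf)
    rw [h1]
    have h2 : ∀ s : Finset ℕ, (∑ i ∈ s, f.coeff i • (xMul δ)^[i] g).coeff k =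
        ∑ i ∈ s, f.coeff i * ((xMul δ)^[i] g).coeff k := by
      intro s
      induction s using Finset.induction_on with
      | empty => simp
      | insert a s ha ih => rw [Finset.sum_insert ha, Finset.sum_insert ha, coeff_add, ih,
          coeff_smul]
    exact h2 _
  refine ⟨fun k hk => ?_, ?_⟩
  · rw [key]
    refine Finset.sum_eq_zero fun i hi => ?_
    rw [(coeff_iterate_xMul i hg).1 k (by have := Finset.mem_range.1 hi; omega), mul_zero]
  · rw [key, Finset.sum_range_succ, (coeff_iterate_xMul m hg).2, Finset.sum_eq_zero, zero_add]
    intro i hi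
    rw [(coeff_iterate_xMul i hg).1 (m + n) (by have := Finset.mem_range.1 hi; omega), mul_zero]

theorem iterate_sigma_ne_zero {a : F} (ha : a ≠ 0) (n : ℕ) : (σ : F → F)^[n] a ≠ 0 := by
  induction n with
  | zero => exact ha
  | succ n ih =>
    rw [Function.iterate_succ_apply']
    simpa using ih

theorem exists_iterate_sigma_eq (σ : F ≃+* F) (b : F) (n : ℕ) : ∃ a, (σ : F → F)^[n] a = b :=
  (σ.surjective.iterate n) b

/-- Right division with remainder. -/
theorem exists_right_division (f g : SkewPoly δ) (hg : g ≠ 0) :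
    ∃ q r : SkewPoly δ, f = q * g + r ∧ r.degree < g.degree := by
  have hg' : ∀ k, g.natDegree < k → g.coeff k = 0 := natDegree_le_iff.1 le_rfl
  have hlc := coeff_natDegree_ne_zero hg
  rw [degree_eq_natDegree hg]
  suffices H : ∀ (N : ℕ) (f : SkewPoly δ), (∀ k, N ≤ k → f.coeff k = 0) →
      ∃ q r : SkewPoly δ, f = q * g + r ∧ r.degree < g.natDegree from
    H (f.natDegree + 1) f fun k hk => natDegree_le_iff.1 le_rfl k (by omega)
  intro N
  induction N with
  | zero =>
    intro f hf
    exact ⟨0, f, by simp, degree_lt_iff.2 fun k _ => hf k (by omega)⟩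
  | succ N ih =>
    intro f hf
    by_cases hN : N < g.natDegree
    · exact ⟨0, f, by simp, degree_lt_iff.2 fun k hk => hf k (by omega)⟩
    · obtain ⟨d, rfl⟩ : ∃ d, N = d + g.natDegree := ⟨N - g.natDegree, by omega⟩
      set c := f.coeff (d + g.natDegree) * ((σ : F → F)^[d] (g.coeff g.natDegree))⁻¹ with hc
      have ht := coeff_mul_top (f := mono δ d c) (g := g) (m := d)
        (fun k hk => by rw [coeff_mono, if_neg (by omega)]) hg'
      obtain ⟨q, r, hqr, hr⟩ := ih (f - mono δ d c * g) (by
        intro k hk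
        rw [coeff_sub]
        rcases hk.eq_or_lt with rfl | hk
        · rw [ht.2, coeff_mono, if_pos rfl, hc, mul_assoc,
            inv_mul_cancel₀ (iterate_sigma_ne_zero hlc d), mul_one, sub_self]
        · rw [ht.1 k hk, hf k (by omega), sub_zero])
      refine ⟨q + mono δ d c, r, ?_, hr⟩
      rw [add_mul, add_right_comm, ← hqr, sub_add_cancel]

/-- Left division with remainder. -/
theorem exists_left_division (f g : SkewPoly δ) (hg : g ≠ 0) :
    ∃ q r : SkewPoly δ, f = g * q + r ∧ r.degree < g.degree := by
  have hg' : ∀ k, g.natDegree < k → g.coeff k = 0 := natDegree_le_iff.1 le_rfl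
  have hlc := coeff_natDegree_ne_zero hg
  rw [degree_eq_natDegree hg]
  suffices H : ∀ (N : ℕ) (f : SkewPoly δ), (∀ k, N ≤ k → f.coeff k = 0) →
      ∃ q r : SkewPoly δ, f = g * q + r ∧ r.degree < g.natDegree from
    H (f.natDegree + 1) f fun k hk => natDegree_le_iff.1 le_rfl k (by omega)
  intro N
  induction N with
  | zero =>
    intro f hf
    exact ⟨0, f, by simp, degree_lt_iff.2 fun k _ => hf k (by omega)⟩
  | succ N ih =>
    intro f hf
    by_cases hN : N < g.natDegree
    · exact ⟨0, f, by simp, degree_lt_iff.2 fun k hk => hf k (by omega)⟩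
    · obtain ⟨d, rfl⟩ : ∃ d, N = g.natDegree + d := ⟨N - g.natDegree, by omega⟩
      obtain ⟨c, hc⟩ := exists_iterate_sigma_eq σ
        ((g.coeff g.natDegree)⁻¹ * f.coeff (g.natDegree + d)) g.natDegree
      have ht := coeff_mul_top (f := g) (g := mono δ d c) (n := d) hg'
        (fun k hk => by rw [coeff_mono, if_neg (by omega)])
      obtain ⟨q, r, hqr, hr⟩ := ih (f - g * mono δ d c) (by
        intro k hk
        rw [coeff_sub]
        rcases hk.eq_or_lt with rfl | hk
        · rw [ht.2, coeff_mono, if_pos rfl, hc, ← mul_assoc,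
            mul_inv_cancel₀ hlc, one_mul, sub_self]
        · rw [ht.1 k hk, hf k (by omega), sub_zero])
      refine ⟨q + mono δ d c, r, ?_, hr⟩
      rw [mul_add, add_right_comm, ← hqr, sub_add_cancel]

theorem degree_lt_of_sub {g r r' : SkewPoly δ} (hr : r.degree < g.degree)
    (hr' : r'.degree < g.degree) : (r - r').degree < g.degree :=
  lt_of_le_of_lt (Polynomial.degree_sub_le (R := F) r r') (max_lt hr hr')

theorem right_division_unique {g q r q' r' : SkewPoly δ} (h : q * g + r = q' * g + r')
    (hr : r.degree < g.degree) (hr' : r'.degree < g.degree) : q = q' ∧ r = r' := by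
  have hg : g ≠ 0 := by
    rintro rfl
    exact not_lt_bot (a := r.degree) hr
  have h1 : (q - q') * g = r' - r := by
    rw [sub_mul, sub_eq_sub_iff_add_eq_add, h, add_comm]
  have h2 : q - q' = 0 := by
    by_contra hq
    have ht := (coeff_mul_top (f := q - q') (g := g) (natDegree_le_iff.1 le_rfl)
      (natDegree_le_iff.1 le_rfl)).2
    have h3 := degree_lt_of_sub hr' hr
    rw [degree_eq_natDegree hg] at h3
    rw [h1, degree_lt_iff.1 h3 _ (by omega)] at ht
    exact mul_ne_zero (coeff_natDegree_ne_zero hq)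
      (iterate_sigma_ne_zero (coeff_natDegree_ne_zero hg) _) ht.symm
  rw [h2, zero_mul] at h1
  exact ⟨sub_eq_zero.1 h2, (sub_eq_zero.1 h1.symm).symm⟩

theorem left_division_unique {g q r q' r' : SkewPoly δ} (h : g * q + r = g * q' + r')
    (hr : r.degree < g.degree) (hr' : r'.degree < g.degree) : q = q' ∧ r = r' := by
  have hg : g ≠ 0 := by
    rintro rfl
    exact not_lt_bot (a := r.degree) hr
  have h1 : g * (q - q') = r' - r := by
    rw [mul_sub, sub_eq_sub_iff_add_eq_add, h, add_comm]
  have h2 : q - q' = 0 := by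
    by_contra hq
    have ht := (coeff_mul_top (f := g) (g := q - q') (natDegree_le_iff.1 le_rfl)
      (natDegree_le_iff.1 le_rfl)).2
    have h3 := degree_lt_of_sub hr' hr
    rw [degree_eq_natDegree hg] at h3
    rw [h1, degree_lt_iff.1 h3 _ (by omega)] at ht
    exact mul_ne_zero (coeff_natDegree_ne_zero hg)
      (iterate_sigma_ne_zero (coeff_natDegree_ne_zero hq) _) ht.symm
  rw [h2, mul_zero] at h1
  exact ⟨sub_eq_zero.1 h2, (sub_eq_zero.1 h1.symm).symm⟩

open Classical in
/-- The quotient `q` upon right division `f = q g + r`, `deg r < deg g` (and `0` if `g = 0`). -/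
noncomputable def rightQuot (f g : SkewPoly δ) : SkewPoly δ :=
  if hg : g = 0 then 0 else (exists_right_division f g hg).choose

open Classical in
/-- The quotient `q` upon left division `f = g q + r`, `deg r < deg g` (and `0` if `g = 0`). -/
noncomputable def leftQuot (f g : SkewPoly δ) : SkewPoly δ :=
  if hg : g = 0 then 0 else (exists_left_division f g hg).choose

/-- The remainder upon right division of `f` by `g`. -/
noncomputable def rightRem (f g : SkewPoly δ) : SkewPoly δ := f - rightQuot f g * g

/-- The remainder upon left division of `f` by `g`. -/
noncomputable def leftRem (f g : SkewPoly δ) : SkewPoly δ := f - g * leftQuot f g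

theorem rightRem_degree_lt (f : SkewPoly δ) {g : SkewPoly δ} (hg : g ≠ 0) :
    (rightRem f g).degree < g.degree := by
  obtain ⟨r, hr, hd⟩ := (exists_right_division f g hg).choose_spec
  have : rightRem f g = r := by
    rw [rightRem, rightQuot, dif_neg hg, sub_eq_iff_eq_add']
    exact hr
  rwa [this]

theorem leftRem_degree_lt (f : SkewPoly δ) {g : SkewPoly δ} (hg : g ≠ 0) :
    (leftRem f g).degree < g.degree := by
  obtain ⟨r, hr, hd⟩ := (exists_left_division f g hg).choose_spec
  have : leftRem f g = r := by
    rw [leftRem, leftQuot, dif_neg hg, sub_eq_iff_eq_add']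
    exact hr
  rwa [this]

/-- The right evaluation `f(a) ∈ F`: the (constant) remainder upon right division by `x - a`. -/
noncomputable def rightEval (f : SkewPoly δ) (a : F) : F := (rightRem f (X δ - C δ a)).coeff 0

/-- The left evaluation `f_L(a) ∈ F`: the (constant) remainder upon left division by `x - a`. -/
noncomputable def leftEval (f : SkewPoly δ) (a : F) : F := (leftRem f (X δ - C δ a)).coeff 0

/-! ### Divisors and greatest common divisors -/

/-- `d` divides `f` on the right. -/
def RightDvd (d f : SkewPoly δ) : Prop := ∃ q, f = q * d

/-- `d` divides `f` on the left. -/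
def LeftDvd (d f : SkewPoly δ) : Prop := ∃ q, f = d * q

/-- The leading coefficient is `1`. -/
def IsMonic (f : SkewPoly δ) : Prop := f.coeff f.natDegree = 1

/-- `d` is the greatest common right divisor of `f` and `g`, normalized to be monic. -/
structure IsGcrd (f g d : SkewPoly δ) : Prop where
  monic : IsMonic d
  dvd_left : RightDvd d f
  dvd_right : RightDvd d g
  greatest : ∀ e, RightDvd e f → RightDvd e g → RightDvd e d

/-- `d` is the greatest common left divisor of `f` and `g`, normalized to be monic. -/
structure IsGcld (f g d : SkewPoly δ) : Prop where
  monic : IsMonic d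
  dvd_left : LeftDvd d f
  dvd_right : LeftDvd d g
  greatest : ∀ e, LeftDvd e f → LeftDvd e g → LeftDvd e d

theorem exists_isGcrd (f g : SkewPoly δ) (h : f ≠ 0 ∨ g ≠ 0) : ∃ d, IsGcrd f g d := by
  classical
  have hex : ∃ n, ∃ p q : SkewPoly δ, p * f + q * g ≠ 0 ∧ (p * f + q * g).natDegree = n := by
    rcases h with h | h
    · exact ⟨_, 1, 0, by simpa using h, rfl⟩
    · exact ⟨_, 0, 1, by simpa using h, rfl⟩
  obtain ⟨p, q, h0, hn⟩ := Nat.find_spec hex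
  set d := p * f + q * g with hd
  have hmin : ∀ p' q' : SkewPoly δ, (p' * f + q' * g).degree < d.degree → p' * f + q' * g = 0 := by
    intro p' q' hlt
    by_contra hne
    rw [degree_eq_natDegree hne, degree_eq_natDegree h0, hn] at hlt
    exact Nat.find_min hex (by exact_mod_cast hlt) ⟨p', q', hne, rfl⟩
  set c := (d.coeff d.natDegree)⁻¹ with hc
  have hc0 : d.coeff d.natDegree ≠ 0 := coeff_natDegree_ne_zero h0
  have hcC : ∀ a : F, C δ a * d = a • d := fun a => mono_mul 0 a d
  have hback : d.coeff d.natDegree • (C δ c * d) = d := by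
    rw [hcC, smul_smul, hc, mul_inv_cancel₀ hc0, one_smul]
  have hdvd : ∀ e, RightDvd d e → RightDvd (C δ c * d) e := by
    rintro e ⟨s, rfl⟩
    refine ⟨s * C δ (d.coeff d.natDegree), ?_⟩
    rw [mul_assoc]
    congr 1
    rw [show C δ (d.coeff d.natDegree) * (C δ c * d) = d.coeff d.natDegree • (C δ c * d) from
      mono_mul 0 _ _, hback]
  have hdf : RightDvd d f := by
    obtain ⟨s, r, hs, hr⟩ := exists_right_division f d h0
    have hr' : r = (1 - s * p) * f + (-(s * q)) * g := by
      have : r = f - s * d := by rw [eq_sub_iff_add_eq', ← hs]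
      rw [this, hd]
      noncomm_ring
    rw [hr'] at hr
    exact ⟨s, by rw [hs, hr', hmin _ _ hr, add_zero]⟩
  have hdg : RightDvd d g := by
    obtain ⟨s, r, hs, hr⟩ := exists_right_division g d h0
    have hr' : r = (-(s * p)) * f + (1 - s * q) * g := by
      have : r = g - s * d := by rw [eq_sub_iff_add_eq', ← hs]
      rw [this, hd]
      noncomm_ring
    rw [hr'] at hr
    exact ⟨s, by rw [hs, hr', hmin _ _ hr, add_zero]⟩
  refine ⟨C δ c * d, ?_, hdvd f hdf, hdvd g hdg, ?_⟩
  · have hcne : c ≠ 0 := inv_ne_zero hc0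
    have hdeg : (C δ c * d).natDegree = d.natDegree := by
      rw [hcC]
      exact Polynomial.natDegree_smul_of_smul_regular (R := F) (p := (d : F[X]))
        (IsSMulRegular.of_ne_zero hcne)
    rw [IsMonic, hdeg, hcC, coeff_smul, hc, inv_mul_cancel₀ hc0]
  · rintro e ⟨s, hs⟩ ⟨t, ht⟩
    refine ⟨C δ c * (p * s + q * t), ?_⟩
    rw [hd]
    nth_rewrite 1 [hs]
    nth_rewrite 1 [ht]
    noncomm_ring

theorem exists_isGcld (f g : SkewPoly δ) (h : f ≠ 0 ∨ g ≠ 0) : ∃ d, IsGcld f g d := by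
  classical
  have hex : ∃ n, ∃ p q : SkewPoly δ, f * p + g * q ≠ 0 ∧ (f * p + g * q).natDegree = n := by
    rcases h with h | h
    · exact ⟨_, 1, 0, by simpa using h, rfl⟩
    · exact ⟨_, 0, 1, by simpa using h, rfl⟩
  obtain ⟨p, q, h0, hn⟩ := Nat.find_spec hex
  set d := f * p + g * q with hd
  have hmin : ∀ p' q' : SkewPoly δ, (f * p' + g * q').degree < d.degree → f * p' + g * q' = 0 := by
    intro p' q' hlt
    by_contra hne
    rw [degree_eq_natDegree hne, degree_eq_natDegree h0, hn] at hlt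
    exact Nat.find_min hex (by exact_mod_cast hlt) ⟨p', q', hne, rfl⟩
  have hc0 : d.coeff d.natDegree ≠ 0 := coeff_natDegree_ne_zero h0
  obtain ⟨c, hc⟩ := exists_iterate_sigma_eq σ (d.coeff d.natDegree)⁻¹ d.natDegree
  have hcne : c ≠ 0 := by
    rintro rfl
    have : (σ : F → F)^[d.natDegree] 0 = 0 := Function.iterate_fixed (map_zero σ) _
    exact inv_ne_zero hc0 (hc.symm.trans this)
  have hCC : C δ c * C δ c⁻¹ = 1 := by
    rw [C, C, mono_mul]
    change c • mono δ 0 c⁻¹ = 1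
    rw [smul_mono, mul_inv_cancel₀ hcne, one_def]
  have hdvd : ∀ e, LeftDvd d e → LeftDvd (d * C δ c) e := by
    rintro e ⟨s, rfl⟩
    refine ⟨C δ c⁻¹ * s, ?_⟩
    rw [mul_assoc, ← mul_assoc (C δ c), hCC, one_mul]
  have hdf : LeftDvd d f := by
    obtain ⟨s, r, hs, hr⟩ := exists_left_division f d h0
    have hr' : r = f * (1 - p * s) + g * (-(q * s)) := by
      have : r = f - d * s := by rw [eq_sub_iff_add_eq', ← hs]
      rw [this, hd]
      noncomm_ring
    rw [hr'] at hr
    exact ⟨s, by rw [hs, hr', hmin _ _ hr, add_zero]⟩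
  have hdg : LeftDvd d g := by
    obtain ⟨s, r, hs, hr⟩ := exists_left_division g d h0
    have hr' : r = f * (-(p * s)) + g * (1 - q * s) := by
      have : r = g - d * s := by rw [eq_sub_iff_add_eq', ← hs]
      rw [this, hd]
      noncomm_ring
    rw [hr'] at hr
    exact ⟨s, by rw [hs, hr', hmin _ _ hr, add_zero]⟩
  refine ⟨d * C δ c, ?_, hdvd f hdf, hdvd g hdg, ?_⟩
  · have ht := coeff_mul_top (f := d) (g := C δ c) (n := 0) (natDegree_le_iff.1 le_rfl)
      (fun k hk => by rw [C, coeff_mono, if_neg (by omega)])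
    have h1 : (d * C δ c).coeff d.natDegree = 1 := by
      have := ht.2
      rw [C, coeff_mono, if_pos rfl, hc, mul_inv_cancel₀ hc0] at this
      exact this
    have hdeg : (d * C δ c).natDegree = d.natDegree :=
      le_antisymm (natDegree_le_iff.2 ht.1) (by
        by_contra hlt
        rw [natDegree_le_iff.1 le_rfl _ (not_le.1 hlt)] at h1
        exact zero_ne_one h1)
    rw [IsMonic, hdeg, h1]
  · rintro e ⟨s, hs⟩ ⟨t, ht⟩
    refine ⟨(s * p + t * q) * C δ c, ?_⟩
    rw [hd]
    nth_rewrite 1 [hs]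
    nth_rewrite 1 [ht]
    noncomm_ring

open Classical in
/-- The monic greatest common right divisor (`0` if `f = g = 0`). -/
noncomputable def gcrd (f g : SkewPoly δ) : SkewPoly δ :=
  if h : f ≠ 0 ∨ g ≠ 0 then (exists_isGcrd f g h).choose else 0

open Classical in
/-- The monic greatest common left divisor (`0` if `f = g = 0`). -/
noncomputable def gcld (f g : SkewPoly δ) : SkewPoly δ :=
  if h : f ≠ 0 ∨ g ≠ 0 then (exists_isGcld f g h).choose else 0

end SkewPoly

/-! ### The Dieudonné determinant -/

open Classical in
/-- The class of `a` in `{0} ∪ Fˣ / [Fˣ, Fˣ]`. -/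
noncomputable def abClass (a : F) : WithZero (Abelianization Fˣ) :=
  if h : a = 0 then 0 else ((Abelianization.of (Units.mk0 a h) : Abelianization Fˣ) :)

open Classical in
/-- The Dieudonné determinant, with values in `{0} ∪ Fˣ / [Fˣ, Fˣ]`, by elimination along the first
column: it is `0` if the first column vanishes; otherwise let `i` be the first row with
`A i 0 ≠ 0`, subtract left multiples `A k 0 * (A i 0)⁻¹` of row `i` from the other rows `k`,
and expand along the first column, where moving row `i` to the top costs the sign `(-1) ^ i`. -/
noncomputable def dieudonneDet : (n : ℕ) → Matrix (Fin n) (Fin n) F → WithZero (Abelianization Fˣ)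
  | 0, _ => 1
  | n + 1, A =>
    if h : ∃ i, A i 0 ≠ 0 then
      let i := Fin.find (fun i => A i 0 ≠ 0) h
      abClass ((-1) ^ (i : ℕ) * A i 0) *
        dieudonneDet n (Matrix.of fun k l =>
          A (i.succAbove k) l.succ - A (i.succAbove k) 0 * (A i 0)⁻¹ * A i l.succ)
    else 0

/-! ### Resultants -/

/-- `𝒞_{d,s}(a)`: the sum over all words in `d` letters `δ` and `s` letters `σ` of the
corresponding compositions evaluated at `a`, sorted by the outermost letter. -/
def cComp (δ : SkewDerivation σ) : ℕ → ℕ → F → F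
  | 0, 0, a => a
  | d + 1, 0, a => δ (cComp δ d 0 a)
  | 0, s + 1, a => σ (cComp δ 0 s a)
  | d + 1, s + 1, a => δ (cComp δ d (s + 1) a) + σ (cComp δ (d + 1) s a)

/-- `𝒯_{d,s}(a)`: the sum over all words in `d` letters `δσ⁻¹` and `s` letters `σ⁻¹` of the
corresponding compositions evaluated at `a`, sorted by the outermost letter. -/
def tComp (δ : SkewDerivation σ) : ℕ → ℕ → F → F
  | 0, 0, a => a
  | d + 1, 0, a => δ (σ.symm (tComp δ d 0 a))
  | 0, s + 1, a => σ.symm (tComp δ 0 s a)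
  | d + 1, s + 1, a => δ (σ.symm (tComp δ d (s + 1) a)) + σ.symm (tComp δ (d + 1) s a)

namespace SkewPoly

variable {δ : SkewDerivation σ}

/-- The coefficient `𝒜ᵢ` of `f = ∑ xⁱ 𝒜ᵢ`, written with coefficients on the right:
`𝒜ᵢ = ∑_{j=0}^{m-i} (-1)ʲ 𝒯_{j,i}(a_{j+i})` for `f = ∑_{i=0}^m aᵢ xⁱ`. -/
noncomputable def rcoeff (f : SkewPoly δ) (i : ℕ) : F :=
  ∑ j ∈ Finset.range (f.natDegree + 1 - i), (-1) ^ j * tComp δ j i (f.coeff (j + i))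

/-- The coefficient of `x^q` in `x^p f`, that is `∑_{l=0}^{p} 𝒞_{p-l,l}(a_{q-l})`
(with `a_t = 0` for `t < 0`). -/
noncomputable def sylvEntry (f : SkewPoly δ) (p q : ℕ) : F :=
  ∑ l ∈ Finset.range (p + 1), if l ≤ q then cComp δ (p - l) l (f.coeff (q - l)) else 0

/-- The right-hand coefficient of `x^q` in `f x^p`, that is
`∑_{l=0}^{p} (-1)^{p-l} 𝒯_{p-l,l}(𝒜_{q-l})` (with `𝒜_t = 0` for `t < 0`). -/
noncomputable def leftSylvEntry (f : SkewPoly δ) (p q : ℕ) : F :=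
  ∑ l ∈ Finset.range (p + 1),
    if l ≤ q then (-1) ^ (p - l) * tComp δ (p - l) l (f.rcoeff (q - l)) else 0

/-- The right Sylvester matrix of `f` and `g`, with `m = deg f` and `n = deg g`: the matrix `A` of
the system `(c₀, …, c_{n-1}, d₀, …, d_{m-1}) * A = 0` that expresses `c f + d g = 0` for
`c = ∑ cᵢ xⁱ`, `d = ∑ dᵢ xⁱ`. The first `n` rows belong to `f`, the last `m` rows to `g`. -/
noncomputable def rightSylvester (f g : SkewPoly δ) :
    Matrix (Fin (g.natDegree + f.natDegree)) (Fin (g.natDegree + f.natDegree)) F :=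
  Matrix.of fun p q =>
    if (p : ℕ) < g.natDegree then f.sylvEntry p q else g.sylvEntry (p - g.natDegree) q

/-- The left Sylvester matrix of `f` and `g`, with `m = deg f` and `n = deg g`: the matrix `M` of
the system `M * (C₀, …, C_{n-1}, D₀, …, D_{m-1})ᵀ = 0` that expresses `f c + g d = 0` for
`c = ∑ xⁱ Cᵢ`, `d = ∑ xⁱ Dᵢ`. The first `n` columns belong to `f`, the last `m` columns to `g`;
row `q` collects the right-hand coefficients of `x^q`. -/
noncomputable def leftSylvester (f g : SkewPoly δ) :
    Matrix (Fin (g.natDegree + f.natDegree)) (Fin (g.natDegree + f.natDegree)) F :=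
  Matrix.of fun q p =>
    if (p : ℕ) < g.natDegree then f.leftSylvEntry p q else g.leftSylvEntry (p - g.natDegree) q

/-- The right `(σ,δ)`-resultant. -/
noncomputable def rightResultant (f g : SkewPoly δ) : WithZero (Abelianization Fˣ) :=
  dieudonneDet _ (rightSylvester f g)

/-- The left `(σ,δ)`-resultant. -/
noncomputable def leftResultant (f g : SkewPoly δ) : WithZero (Abelianization Fˣ) :=
  dieudonneDet _ (leftSylvester f g)

/-! ### Derivative polynomials and multiplicity sequences

A sequence `(a₁, …, a_r)` is a function `a : Fin r → F`, so `a_{i+1}` is `a i`. -/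

/-- `P_a = (x - a_r) ⋯ (x - a₂) (x - a₁)`. -/
noncomputable def rightP (δ : SkewDerivation σ) {r : ℕ} (a : Fin r → F) : SkewPoly δ :=
  (List.ofFn fun i => X δ - C δ (a i)).reverse.prod

/-- `P_{a,L} = (x - a₁) (x - a₂) ⋯ (x - a_r)`. -/
noncomputable def leftP (δ : SkewDerivation σ) {r : ℕ} (a : Fin r → F) : SkewPoly δ :=
  (List.ofFn fun i => X δ - C δ (a i)).prod

/-- The right derivative polynomial `Δ_a f`: the quotient upon right division of `f` by `P_a`.
For the empty sequence `P_a = 1` and `Δ_a f = f`. -/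
noncomputable def rightDeriv (f : SkewPoly δ) {r : ℕ} (a : Fin r → F) : SkewPoly δ :=
  rightQuot f (rightP δ a)

/-- The left derivative polynomial `Δ_{a,L} f`: the quotient upon left division of `f` by
`P_{a,L}`. For the empty sequence `P_{a,L} = 1` and `Δ_{a,L} f = f`. -/
noncomputable def leftDeriv (f : SkewPoly δ) {r : ℕ} (a : Fin r → F) : SkewPoly δ :=
  leftQuot f (leftP δ a)

/-- `a` is a right multiplicity sequence: `a₁` is the only right root of `P_a`. -/
def IsRightMultiplicitySeq (δ : SkewDerivation σ) {r : ℕ} (a : Fin r → F) : Prop :=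
  ∃ hr : 0 < r, ∀ b : F, (rightP δ a).rightEval b = 0 ↔ b = a ⟨0, hr⟩

/-- `a` is a left multiplicity sequence: `a₁` is the only left root of `P_{a,L}`. -/
def IsLeftMultiplicitySeq (δ : SkewDerivation σ) {r : ℕ} (a : Fin r → F) : Prop :=
  ∃ hr : 0 < r, ∀ b : F, (leftP δ a).leftEval b = 0 ↔ b = a ⟨0, hr⟩

/-- For a right multiplicity sequence `a` of length `r`: `a₁` is a right root of `f` of
multiplicity `r` via `a`. -/
def IsRightRootVia (f : SkewPoly δ) {r : ℕ} (a : Fin r → F) : Prop := RightDvd (rightP δ a) f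

/-- For a left multiplicity sequence `a` of length `r`: `a₁` is a left root of `f` of
multiplicity `r` via `a`. -/
def IsLeftRootVia (f : SkewPoly δ) {r : ℕ} (a : Fin r → F) : Prop := LeftDvd (leftP δ a) f

end SkewPoly

end OreExtension

/-! ### Vanishing of the Dieudonné determinant and kernels -/

section DieudonneKernel

variable {F : Type u} [DivisionRing F]

/-! In the right case put `g = Δ_{a_i} f` and `h = Δ_{a_{i+1}} f`. Since `P_{a_{i+1}} = (x -
a_{i+1}) P_{a_i}`, uniqueness of right division gives `g = h (x - a_{i+1}) + c` with the constant `c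
= g(a_{i+1})` (`rightDeriv_castSucc`). For this `i`, each of conditions 2, 3 and 4 says exactly that
`c = 0`. The quotient `h` stands on the left of the product, which is why the right case uses left
divisors and the left resultant. The left case is the mirror image.

Divisors: a common left divisor of `g` and `h` divides `c` on the left, so it is constant when `c ≠
0`. When `c = 0`, `h` itself is a common left divisor, and it is not constant because `r < deg f`
(`gcld_ne_one_iff_of_eq`).

Resultants: `R_L(g, h) = 0` means that `g p + h q = 0` has a nontrivial solution with `deg p < deg
h` and `deg q < deg g` (`leftResultant_eq_zero_iff`). Substituting for `g` turns this into `h ((x -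
a_{i+1}) p + q) = -c p`. For `c ≠ 0` a comparison of degrees forces `p = 0`, then `q = 0`; for `c =
0` the pair `(1, -(x - a_{i+1}))` is a solution (`leftResultant_eq_zero_iff_of_eq`).

The description of the resultants rests on two facts. Elimination shows that the Dieudonné
determinant vanishes exactly when there is a nonzero kernel vector, on either side. The explicit
Sylvester entries are the coefficients of `x^p f` and `f x^p`, because sums over words in two
letters obey the same recursion as multiplication by `x` (`wordConv_succ_succ`).

Conditions 1 and 2 are linked by peeling linear factors off `P_a` one at a time
(`rightDvd_rightP_succ`). -/

theorem abClass_eq_zero_iff (a : F) : abClass a = 0 ↔ a = 0 := by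
  unfold abClass
  split_ifs with h
  · simp [h]
  · simp [h]

open Classical in
/-- The Dieudonné determinant vanishes iff the matrix has a nontrivial right kernel. -/
theorem dieudonneDet_eq_zero_iff_mulVec : ∀ (n : ℕ) (A : Matrix (Fin n) (Fin n) F),
    dieudonneDet n A = 0 ↔ ∃ v : Fin n → F, v ≠ 0 ∧ A.mulVec v = 0
  | 0, A => by
    simp only [dieudonneDet, one_ne_zero, false_iff, not_exists, not_and]
    exact fun v hv => absurd (Subsingleton.elim v 0) hv
  | n + 1, A => by
    by_cases h : ∃ i, A i 0 ≠ 0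
    · rw [dieudonneDet, dif_pos h]
      simp only
      set i := Fin.find (fun i => A i 0 ≠ 0) h with hi
      have hi0 : A i 0 ≠ 0 := Fin.find_spec h
      rw [mul_eq_zero, abClass_eq_zero_iff, mul_eq_zero, dieudonneDet_eq_zero_iff_mulVec n]
      have hpow : ((-1 : F) ^ (i : ℕ)) ≠ 0 := pow_ne_zero _ (neg_ne_zero.2 one_ne_zero)
      simp only [hpow, hi0, false_or]
      -- The coordinate `v 0` cancels when the multiple of the pivot row is subtracted, so only the
      -- tail of `v` meets the reduced matrix.
      have hrow : ∀ (v : Fin (n + 1) → F) (k : Fin n),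
          ∑ l : Fin n, (A (i.succAbove k) l.succ - A (i.succAbove k) 0 * (A i 0)⁻¹ * A i l.succ) * v l.succ
            = A.mulVec v (i.succAbove k) - A (i.succAbove k) 0 * (A i 0)⁻¹ * A.mulVec v i := by
        intro v k
        simp only [Matrix.mulVec, dotProduct, Fin.sum_univ_succ, sub_mul,
          Finset.sum_sub_distrib, mul_add, Finset.mul_sum, mul_assoc]
        rw [inv_mul_cancel_left₀ hi0]
        abel
      constructor
      · rintro ⟨w, hw, hAw⟩
        -- The first coordinate is obtained by solving the pivot row's equation.
        set v : Fin (n + 1) → F := Fin.cons (-((A i 0)⁻¹ * ∑ l, A i (Fin.succ l) * w l)) w with hv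
        have hvi : A.mulVec v i = 0 := by
          simp only [Matrix.mulVec, dotProduct, Fin.sum_univ_succ, hv, Fin.cons_zero,
            Fin.cons_succ]
          rw [mul_neg, mul_inv_cancel_left₀ hi0, neg_add_cancel]
        refine ⟨v, fun h0 => hw (funext fun l => ?_), funext fun k => ?_⟩
        · simpa [hv] using congrFun h0 l.succ
        · rcases Fin.eq_self_or_eq_succAbove i k with rfl | ⟨k, rfl⟩
          · exact hvi
          · have h1 := hrow v k
            rw [hvi, mul_zero, sub_zero] at h1
            rw [← h1]
            have h2 := congrFun hAw k
            simpa [Matrix.mulVec, dotProduct, hv] using h2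
      · rintro ⟨v, hv, hAv⟩
        refine ⟨fun l => v l.succ, fun h0 => hv ?_, funext fun k => ?_⟩
        · have hs : ∀ l : Fin n, v l.succ = 0 := fun l => congrFun h0 l
          have h1 := congrFun hAv i
          simp only [Matrix.mulVec, dotProduct, Fin.sum_univ_succ, hs, mul_zero,
            Finset.sum_const_zero, add_zero, Pi.zero_apply] at h1
          have h2 : v 0 = 0 := (mul_eq_zero.1 h1).resolve_left hi0
          funext l
          exact Fin.cases h2 hs l
        · have h1 := hrow v k
          rw [hAv] at h1
          simpa [Matrix.mulVec, dotProduct] using h1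
    · rw [dieudonneDet, dif_neg h]
      push Not at h
      -- A zero first column is annihilated by the first basis vector.
      refine ⟨fun _ => ⟨Pi.single 0 1, by simp, funext fun k => ?_⟩, fun _ => rfl⟩
      simp [h]

open Classical in
/-- The Dieudonné determinant vanishes iff the matrix has a nontrivial left kernel. -/
theorem dieudonneDet_eq_zero_iff_vecMul : ∀ (n : ℕ) (A : Matrix (Fin n) (Fin n) F),
    dieudonneDet n A = 0 ↔ ∃ v : Fin n → F, v ≠ 0 ∧ Matrix.vecMul v A = 0
  | 0, A => by
    simp only [dieudonneDet, one_ne_zero, false_iff, not_exists, not_and]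
    exact fun v hv => absurd (Subsingleton.elim v 0) hv
  | n + 1, A => by
    by_cases h : ∃ i, A i 0 ≠ 0
    · rw [dieudonneDet, dif_pos h]
      simp only
      set i := Fin.find (fun i => A i 0 ≠ 0) h with hi
      have hi0 : A i 0 ≠ 0 := Fin.find_spec h
      rw [mul_eq_zero, abClass_eq_zero_iff, mul_eq_zero, dieudonneDet_eq_zero_iff_vecMul n]
      have hpow : ((-1 : F) ^ (i : ℕ)) ≠ 0 := pow_ne_zero _ (neg_ne_zero.2 one_ne_zero)
      simp only [hpow, hi0, false_or]
      -- Column `0` gives `∑ v_k A_{k0} = -v_i A_{i0}` over `k ≠ i`; the elimination terms therefore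
      -- add up to the missing contribution of row `i`.
      have hcol : ∀ v : Fin (n + 1) → F, Matrix.vecMul v A 0 = 0 → ∀ l : Fin n,
          ∑ k, v (i.succAbove k) *
            (A (i.succAbove k) l.succ - A (i.succAbove k) 0 * (A i 0)⁻¹ * A i l.succ)
            = Matrix.vecMul v A l.succ := by
        intro v hv l
        simp only [Matrix.vecMul, dotProduct, Fin.sum_univ_succAbove _ i] at hv ⊢
        have h1 : ∑ k, v (i.succAbove k) * A (i.succAbove k) 0 = -(v i * A i 0) :=
          eq_neg_of_add_eq_zero_right hv
        simp only [mul_sub, Finset.sum_sub_distrib, ← mul_assoc, ← Finset.sum_mul]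
        rw [h1, neg_mul, mul_inv_cancel_right₀ hi0]
        simp only [neg_mul, sub_neg_eq_add]
        abel
      constructor
      · rintro ⟨w, hw, hAw⟩
        -- The entry at the pivot position is the one that makes column `0` vanish.
        set v : Fin (n + 1) → F :=
          i.insertNth (-((∑ k, w k * A (i.succAbove k) 0) * (A i 0)⁻¹)) w with hv
        have hv0 : Matrix.vecMul v A 0 = 0 := by
          simp only [Matrix.vecMul, dotProduct, Fin.sum_univ_succAbove _ i, hv,
            Fin.insertNth_apply_same, Fin.insertNth_apply_succAbove]
          rw [neg_mul, inv_mul_cancel_right₀ hi0, neg_add_cancel]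
        refine ⟨v, fun h0 => hw (funext fun k => ?_), funext fun l => ?_⟩
        · simpa [hv] using congrFun h0 (i.succAbove k)
        · refine Fin.cases hv0 (fun l => ?_) l
          rw [← hcol v hv0 l]
          simpa [Matrix.vecMul, dotProduct, hv] using congrFun hAw l
      · rintro ⟨v, hv, hAv⟩
        have hv0 := congrFun hAv 0
        refine ⟨fun k => v (i.succAbove k), fun h0 => hv ?_, funext fun l => ?_⟩
        · have hs : ∀ k : Fin n, v (i.succAbove k) = 0 := fun k => congrFun h0 k
          simp only [Matrix.vecMul, dotProduct, Fin.sum_univ_succAbove _ i, hs, zero_mul,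
            Finset.sum_const_zero, add_zero, Pi.zero_apply] at hv0
          funext k
          rcases Fin.eq_self_or_eq_succAbove i k with rfl | ⟨k, rfl⟩
          · exact (mul_eq_zero.1 hv0).resolve_right hi0
          · exact hs k
        · have h1 := hcol v hv0 l
          rw [hAv] at h1
          simpa [Matrix.vecMul, dotProduct] using h1
    · rw [dieudonneDet, dif_neg h]
      push Not at h
      refine ⟨fun _ => ?_, fun _ => rfl⟩
      -- Without the zero column, `n + 1` unknowns face only `n` equations.
      have hker := LinearMap.ker_ne_bot_of_finrank_lt
        (f := Matrix.vecMulLinear (A.submatrix id Fin.succ)) (by simp)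
      obtain ⟨v, hv, hv0⟩ := Submodule.exists_mem_ne_zero_of_ne_bot hker
      refine ⟨v, hv0, funext fun l => Fin.cases ?_ (fun l => ?_) l⟩
      · simp [Matrix.vecMul, dotProduct, h]
      · exact congrFun (LinearMap.mem_ker.1 hv) l

end DieudonneKernel

namespace SkewPoly

variable {F : Type u} [DivisionRing F] {σ : F ≃+* F} {δ : SkewDerivation σ}

/-! ### Sums over words in two letters -/

section Words

/-- The sum over all words in `d` letters `φ` and `s` letters `ψ` of the corresponding
compositions, sorted by the outermost letter. -/
def wordSum (φ ψ : F →+ F) : ℕ → ℕ → F → F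
  | 0, 0, a => a
  | d + 1, 0, a => φ (wordSum φ ψ d 0 a)
  | 0, s + 1, a => ψ (wordSum φ ψ 0 s a)
  | d + 1, s + 1, a => φ (wordSum φ ψ d (s + 1) a) + ψ (wordSum φ ψ (d + 1) s a)

/-- `∑_{l ≤ p} wordSum (p - l) l (u (q - l))`, with `u t = 0` for `t < 0`. -/
def wordConv (φ ψ : F →+ F) (u : ℕ → F) (p q : ℕ) : F :=
  ∑ l ∈ Finset.range (p + 1), if l ≤ q then wordSum φ ψ (p - l) l (u (q - l)) else 0

variable (φ ψ : F →+ F)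

theorem wordSum_zero : ∀ d s : ℕ, wordSum φ ψ d s 0 = 0
  | 0, 0 => by rw [wordSum]
  | d + 1, 0 => by rw [wordSum, wordSum_zero, map_zero]
  | 0, s + 1 => by rw [wordSum, wordSum_zero, map_zero]
  | d + 1, s + 1 => by rw [wordSum, wordSum_zero, wordSum_zero, map_zero, map_zero, add_zero]

theorem wordConv_zero (u : ℕ → F) (q : ℕ) : wordConv φ ψ u 0 q = u q := by
  simp [wordConv, wordSum]

theorem wordConv_succ_zero (u : ℕ → F) (p : ℕ) :
    wordConv φ ψ u (p + 1) 0 = φ (wordConv φ ψ u p 0) := by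
  simp [wordConv, wordSum]

/-- Words of length `p + 1` are sorted by their outermost letter: removing a `ψ` lowers the position
`q + 1` to `q`, removing a `φ` keeps it. With `φ = δ`, `ψ = σ` this is the coefficient rule for left
multiplication by `x`. -/
theorem wordConv_succ_succ (u : ℕ → F) (p q : ℕ) :
    wordConv φ ψ u (p + 1) (q + 1) =
      ψ (wordConv φ ψ u p q) + φ (wordConv φ ψ u p (q + 1)) := by
  -- Both parts are written over the full range of `l`. A word with outermost `φ` has at most `p`
  -- letters `ψ`, hence the condition `l ≤ p`.
  have hφ : φ (wordConv φ ψ u p (q + 1)) = ∑ l ∈ Finset.range (p + 2),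
      if l ≤ q + 1 ∧ l ≤ p then φ (wordSum φ ψ (p - l) l (u (q + 1 - l))) else 0 := by
    rw [Finset.sum_range_succ, if_neg (by omega), add_zero, wordConv, map_sum]
    refine Finset.sum_congr rfl fun l hl => ?_
    have := Finset.mem_range.1 hl
    by_cases h : l ≤ q + 1
    · rw [if_pos h, if_pos ⟨h, by omega⟩]
    · rw [if_neg h, if_neg (by tauto), map_zero]
  -- Here `l` is shifted by one, as it now counts the outermost `ψ` as well.
  have hψ : ψ (wordConv φ ψ u p q) = ∑ l ∈ Finset.range (p + 2),
      if 1 ≤ l ∧ l ≤ q + 1 then ψ (wordSum φ ψ (p + 1 - l) (l - 1) (u (q + 1 - l))) else 0 := by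
    rw [Finset.sum_range_succ' _ (p + 1), if_neg (by omega), add_zero, wordConv, map_sum]
    refine Finset.sum_congr rfl fun l _ => ?_
    by_cases h : l ≤ q
    · rw [if_pos h, if_pos ⟨by omega, by omega⟩, Nat.add_sub_add_right, Nat.add_sub_add_right,
        Nat.add_sub_add_right, Nat.sub_zero]
    · rw [if_neg h, if_neg (by omega), map_zero]
  rw [hφ, hψ, ← Finset.sum_add_distrib, wordConv]
  refine Finset.sum_congr rfl fun l hl => ?_
  have hlp := Finset.mem_range.1 hl
  by_cases h : l ≤ q + 1
  · rw [if_pos h]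
    -- At `l = 0` there are only letters `φ`, at `l = p + 1` only letters `ψ`; in between both parts
    -- contribute.
    rcases l with _ | s
    · rw [if_neg (by omega), if_pos (by omega), zero_add, Nat.sub_zero, Nat.sub_zero, Nat.sub_zero, wordSum]
    · rw [if_pos (by omega)]
      by_cases hs : s + 1 ≤ p
      · obtain ⟨d, rfl⟩ : ∃ d, p = d + (s + 1) := ⟨p - (s + 1), by omega⟩
        rw [if_pos ⟨h, hs⟩, show d + (s + 1) + 1 - (s + 1) = d + 1 by omega,
          Nat.add_sub_cancel, Nat.add_sub_cancel, wordSum, add_comm]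
      · obtain rfl : s = p := by omega
        rw [if_neg (by omega), add_zero, Nat.sub_self, Nat.add_sub_cancel, wordSum]
  · rw [if_neg h, if_neg (by omega), if_neg (by omega), add_zero]

/-- Only `l = q` meets the support of the sequence. This gives the right-hand coefficients of a
single term `a x^p`. -/
theorem wordConv_single (a : F) (p q : ℕ) :
    wordConv φ ψ (Pi.single 0 a) p q = if q ≤ p then wordSum φ ψ (p - q) q a else 0 := by
  rw [wordConv]
  have h : ∀ l ∈ Finset.range (p + 1),
      (if l ≤ q then wordSum φ ψ (p - l) l ((Pi.single 0 a : ℕ → F) (q - l)) else 0) =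
        if q = l then wordSum φ ψ (p - q) q a else 0 := by
    intro l _
    rcases lt_trichotomy l q with hl | rfl | hl
    · rw [if_pos hl.le, if_neg hl.ne', Pi.single_eq_of_ne (by omega), wordSum_zero]
    · simp
    · rw [if_neg (by omega), if_neg hl.ne]
  rw [Finset.sum_congr rfl h, Finset.sum_ite_eq]
  simp only [Finset.mem_range, Nat.lt_succ_iff]

theorem cComp_eq_wordSum (δ : SkewDerivation σ) : ∀ (d s : ℕ) (a : F),
    cComp δ d s a = wordSum δ.toFun (σ : F →+* F).toAddMonoidHom d s a
  | 0, 0, a => by rw [cComp, wordSum]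
  | d + 1, 0, a => by rw [cComp, wordSum, cComp_eq_wordSum δ d 0]
  | 0, s + 1, a => by rw [cComp, wordSum, cComp_eq_wordSum δ 0 s]; rfl
  | d + 1, s + 1, a => by
    rw [cComp, wordSum, cComp_eq_wordSum δ d (s + 1), cComp_eq_wordSum δ (d + 1) s]; rfl

/-- The additive map `a ↦ -δ (σ⁻¹ a)`. -/
def negDeltaSymm (δ : SkewDerivation σ) : F →+ F :=
  -(δ.toFun.comp (σ.symm : F →+* F).toAddMonoidHom)

theorem negDeltaSymm_apply (a : F) : negDeltaSymm δ a = -δ (σ.symm a) := rfl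

/-- The sign `(-1)^d` is distributed over the `d` letters `δσ⁻¹`, one to each; the signed sums thus
become word sums for two additive maps. -/
theorem neg_one_pow_mul_tComp (δ : SkewDerivation σ) : ∀ (d s : ℕ) (a : F),
    (-1) ^ d * tComp δ d s a =
      wordSum (negDeltaSymm δ) (σ.symm : F →+* F).toAddMonoidHom d s a
  | 0, 0, a => by simp [tComp, wordSum]
  | d + 1, 0, a => by
    rw [wordSum, ← neg_one_pow_mul_tComp δ d 0, tComp, negDeltaSymm_apply]
    -- The power is replaced by `1` or `-1`, which additive maps respect.
    rcases neg_one_pow_eq_or F d with h | h <;> simp [pow_succ, h]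
  | 0, s + 1, a => by
    rw [wordSum, ← neg_one_pow_mul_tComp δ 0 s, tComp]
    simp
  | d + 1, s + 1, a => by
    rw [wordSum, ← neg_one_pow_mul_tComp δ d (s + 1), ← neg_one_pow_mul_tComp δ (d + 1) s, tComp,
      negDeltaSymm_apply]
    rcases neg_one_pow_eq_or F d with h | h <;> simp [pow_succ, h, add_comm]

theorem sylvEntry_eq_wordConv (f : SkewPoly δ) (p q : ℕ) :
    f.sylvEntry p q = wordConv δ.toFun (σ : F →+* F).toAddMonoidHom f.coeff p q := by
  simp only [sylvEntry, wordConv, cComp_eq_wordSum]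

theorem leftSylvEntry_eq_wordConv (f : SkewPoly δ) (p q : ℕ) :
    f.leftSylvEntry p q =
      wordConv (negDeltaSymm δ) (σ.symm : F →+* F).toAddMonoidHom f.rcoeff p q := by
  simp only [leftSylvEntry, wordConv, neg_one_pow_mul_tComp]

end Words

end SkewPoly

namespace SkewPoly

variable {F : Type u} [DivisionRing F] {σ : F ≃+* F} {δ : SkewDerivation σ}

/-! ### Expansions with left-hand and right-hand coefficients -/

section Expansions

theorem C_mul (a : F) (f : SkewPoly δ) : C δ a * f = a • f := mono_mul 0 a f

theorem X_mul (f : SkewPoly δ) : X δ * f = xMul δ f := by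
  rw [X, mono_mul, one_smul, Function.iterate_one]

theorem C_add (a b : F) : C δ (a + b) = C δ a + C δ b := map_add (mono δ 0) a b

theorem C_neg (a : F) : C δ (-a) = -C δ a := map_neg (mono δ 0) a

theorem C_zero : C δ (0 : F) = 0 := map_zero (mono δ 0)

theorem C_sum {ι : Type*} (s : Finset ι) (u : ι → F) :
    C δ (∑ i ∈ s, u i) = ∑ i ∈ s, C δ (u i) := map_sum (mono δ 0) u s

theorem coeff_C (a : F) (k : ℕ) : (C δ a).coeff k = if 0 = k then a else 0 := coeff_mono 0 a k

theorem X_pow (n : ℕ) : (X δ) ^ n = mono δ n 1 := by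
  rw [← xMul_iterate_one]
  induction n with
  | zero => rfl
  | succ n ih => rw [pow_succ', ih, X_mul, Function.iterate_succ_apply']

theorem C_mul_X_pow (a : F) (n : ℕ) : C δ a * (X δ) ^ n = mono δ n a := by
  rw [X_pow, C_mul, smul_mono, mul_one]

theorem coeff_sum {ι : Type*} (s : Finset ι) (u : ι → SkewPoly δ) (k : ℕ) :
    (∑ i ∈ s, u i).coeff k = ∑ i ∈ s, (u i).coeff k :=
  Polynomial.finsetSum_coeff (R := F) s u k

theorem coeff_eq_zero_of_natDegree_lt {f : SkewPoly δ} {k : ℕ} (h : f.natDegree < k) :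
    f.coeff k = 0 :=
  natDegree_le_iff.1 le_rfl k h

/-- A skew polynomial with left-hand coefficients. -/
theorem eq_sum_C_mul_X_pow (f : SkewPoly δ) {N : ℕ} (h : ∀ k, N ≤ k → f.coeff k = 0) :
    f = ∑ n ∈ Finset.range N, C δ (f.coeff n) * (X δ) ^ n := by
  refine ext' fun k => ?_
  simp only [coeff_sum, C_mul_X_pow, coeff_mono, Finset.sum_ite_eq', Finset.mem_range]
  split_ifs with hk
  · rfl
  · exact h k (not_lt.1 hk)

theorem coeff_xMul_zero (g : SkewPoly δ) : (xMul δ g).coeff 0 = δ (g.coeff 0) := by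
  induction g using SkewPoly.induction with
  | hadd p q hp hq => rw [xMul_add, coeff_add, hp, hq, coeff_add, map_add]
  | hmono k b =>
    rw [xMul_mono, coeff_add, coeff_mono, coeff_mono, coeff_mono]
    split_ifs <;> simp_all

/-- The entries of the right Sylvester matrix are the coefficients of `x^p f`. -/
theorem coeff_X_pow_mul (f : SkewPoly δ) (p q : ℕ) :
    ((X δ) ^ p * f).coeff q = f.sylvEntry p q := by
  rw [sylvEntry_eq_wordConv]
  induction p generalizing q with
  | zero => rw [pow_zero, one_mul, wordConv_zero]
  | succ p ih =>
    rw [pow_succ', mul_assoc, X_mul]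
    rcases q with _ | q
    · rw [coeff_xMul_zero, ih, wordConv_succ_zero]
    · rw [coeff_xMul_succ, ih, ih, wordConv_succ_succ]
      rfl

/-- `f = ∑_{q < N} x^q u_q`, an expansion with right-hand coefficients. -/
structure RightExpansion (f : SkewPoly δ) (u : ℕ → F) (N : ℕ) : Prop where
  eq_sum : f = ∑ q ∈ Finset.range N, (X δ) ^ q * C δ (u q)
  eq_zero : ∀ q, N ≤ q → u q = 0

namespace RightExpansion

theorem mono_right {f : SkewPoly δ} {u : ℕ → F} {N N' : ℕ} (h : RightExpansion f u N)
    (hN : N ≤ N') : RightExpansion f u N' := by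
  refine ⟨?_, fun q hq => h.eq_zero q (hN.trans hq)⟩
  rw [h.eq_sum]
  refine Finset.sum_subset (Finset.range_subset_range.2 hN) fun q _ hq => ?_
  rw [h.eq_zero q (by simpa using hq), C_zero, mul_zero]

theorem sum {ι : Type*} (s : Finset ι) {f : ι → SkewPoly δ} {u : ι → ℕ → F} {N : ℕ}
    (h : ∀ i ∈ s, RightExpansion (f i) (u i) N) :
    RightExpansion (∑ i ∈ s, f i) (fun q => ∑ i ∈ s, u i q) N := by
  refine ⟨?_, fun q hq => Finset.sum_eq_zero fun i hi => (h i hi).eq_zero q hq⟩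
  rw [Finset.sum_congr rfl fun i hi => (h i hi).eq_sum, Finset.sum_comm]
  simp only [C_sum, Finset.mul_sum]

theorem add {f g : SkewPoly δ} {u v : ℕ → F} {N : ℕ} (hf : RightExpansion f u N)
    (hg : RightExpansion g v N) : RightExpansion (f + g) (fun q => u q + v q) N := by
  refine ⟨?_, fun q hq => by rw [hf.eq_zero q hq, hg.eq_zero q hq, add_zero]⟩
  conv_lhs => rw [hf.eq_sum, hg.eq_sum]
  simp only [C_add, mul_add, Finset.sum_add_distrib]

theorem mul_C {f : SkewPoly δ} {u : ℕ → F} {N : ℕ} (h : RightExpansion f u N) (c : F) :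
    RightExpansion (f * C δ c) (fun q => u q * c) N := by
  refine ⟨?_, fun q hq => by rw [h.eq_zero q hq, zero_mul]⟩
  conv_lhs => rw [h.eq_sum]
  rw [Finset.sum_mul]
  refine Finset.sum_congr rfl fun q _ => ?_
  rw [mul_assoc, C_mul, C, C, smul_mono]

/-- This is `x b = σ(b) x + δ(b)` at `b = σ⁻¹(a)`, solved for `a x`. -/
theorem C_mul_X (a : F) : C δ a * X δ = X δ * C δ (σ.symm a) + C δ (negDeltaSymm δ a) := by
  rw [X_mul_C, RingEquiv.apply_symm_apply, negDeltaSymm_apply, C_neg, add_neg_cancel_right]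

/-- Each constant is moved past `x` by `C_mul_X`. The two conditions on `v` are the recursion of
`wordConv` for the letters `-δσ⁻¹` and `σ⁻¹`, so iteration yields `mul_X_pow`. -/
theorem mul_X {f : SkewPoly δ} {u v : ℕ → F} {N : ℕ} (h : RightExpansion f u N)
    (h0 : v 0 = negDeltaSymm δ (u 0))
    (hs : ∀ q, v (q + 1) = σ.symm (u q) + negDeltaSymm δ (u (q + 1))) :
    RightExpansion (f * X δ) v (N + 1) := by
  refine ⟨?_, fun q hq => ?_⟩
  · conv_lhs => rw [(h.mono_right N.le_succ).eq_sum, Finset.sum_mul]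
    simp only [mul_assoc, C_mul_X, mul_add, Finset.sum_add_distrib]
    rw [Finset.sum_range_succ, h.eq_zero N le_rfl, map_zero, C_zero, mul_zero, mul_zero, add_zero,
      Finset.sum_range_succ' (n := N), Finset.sum_range_succ' (n := N), h0, ← add_assoc,
      ← Finset.sum_add_distrib]
    congr 1
    refine Finset.sum_congr rfl fun q _ => ?_
    rw [hs, C_add, mul_add, pow_succ, mul_assoc, mul_assoc]
  · obtain ⟨q, rfl⟩ : ∃ k, q = k + 1 := ⟨q - 1, by omega⟩
    rw [hs, h.eq_zero q (by omega), h.eq_zero (q + 1) (by omega), map_zero, map_zero, add_zero]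

theorem mul_X_pow {f : SkewPoly δ} {u : ℕ → F} {N : ℕ} (h : RightExpansion f u N) (p : ℕ) :
    RightExpansion (f * (X δ) ^ p)
      (wordConv (negDeltaSymm δ) (σ.symm : F →+* F).toAddMonoidHom u p) (N + p) := by
  induction p with
  | zero =>
    rw [pow_zero, mul_one, show wordConv _ _ u 0 = u from funext fun q => wordConv_zero _ _ u q]
    exact h
  | succ p ih =>
    rw [pow_succ, ← mul_assoc]
    exact ih.mul_X (wordConv_succ_zero _ _ u p) (fun q => wordConv_succ_succ _ _ u p q)

theorem const (a : F) : RightExpansion (C δ a) (Pi.single 0 a) 1 := by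
  refine ⟨by simp, fun q hq => Pi.single_eq_of_ne (by omega) _⟩

/-- A skew polynomial that vanishes has vanishing right-hand coefficients. -/
theorem eq_zero_of_zero {u : ℕ → F} {N : ℕ} (h : RightExpansion (0 : SkewPoly δ) u N) (q : ℕ) :
    u q = 0 := by
  induction N with
  | zero => exact h.eq_zero q (Nat.zero_le q)
  | succ N ih =>
    -- The term `x^q u_q` has top coefficient `σ^q(u_q)`, so the highest right-hand coefficient can
    -- be read off and removed.
    have htop : ∀ q, (∀ k, q < k → ((X δ) ^ q * C δ (u q)).coeff k = 0) ∧
        ((X δ) ^ q * C δ (u q)).coeff q = (σ : F → F)^[q] (u q) := by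
      intro q
      have := coeff_mul_top (f := (X δ) ^ q) (g := C δ (u q)) (m := q) (n := 0)
        (fun k hk => by rw [X_pow, coeff_mono, if_neg hk.ne])
        (fun k hk => by rw [coeff_C, if_neg hk.ne])
      rw [X_pow] at this ⊢
      simpa [coeff_mono, coeff_C] using this
    have hN : u N = 0 := by
      by_contra hne
      have h1 := congrArg (fun g => g.coeff N) h.eq_sum
      simp only [coeff_zero, Finset.sum_range_succ] at h1
      rw [coeff_add, coeff_sum, Finset.sum_eq_zero fun q hq => (htop q).1 N (Finset.mem_range.1 hq), zero_add,
        (htop N).2] at h1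
      exact iterate_sigma_ne_zero hne N h1.symm
    refine ih ⟨?_, fun q hq => ?_⟩
    · have h1 := h.eq_sum
      rwa [Finset.sum_range_succ, hN, C_zero, mul_zero, add_zero] at h1
    · rcases hq.eq_or_lt with rfl | hq
      · exact hN
      · exact h.eq_zero q hq

end RightExpansion

/-- Each term `a_n x^n` is expanded from the constant `a_n` by `mul_X_pow`. It contributes to `x^q`
only for `n = q + j` with `j ≥ 0`, and collecting over `j` gives the formula for `𝒜_q`. -/
theorem rightExpansion_rcoeff (f : SkewPoly δ) :
    RightExpansion f f.rcoeff (f.natDegree + 1) := by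
  have h1 := RightExpansion.sum (Finset.range (f.natDegree + 1)) fun n hn =>
    ((RightExpansion.const (δ := δ) (f.coeff n)).mul_X_pow n).mono_right
      (show 1 + n ≤ f.natDegree + 1 by have := Finset.mem_range.1 hn; omega)
  rw [← eq_sum_C_mul_X_pow f fun k hk => coeff_eq_zero_of_natDegree_lt (by omega)] at h1
  convert h1 using 1
  funext q
  simp only [wordConv_single, rcoeff, neg_one_pow_mul_tComp]
  have hI : Finset.filter (q ≤ ·) (Finset.range (f.natDegree + 1)) =
      Finset.Ico q (f.natDegree + 1) := by
    ext n
    simp only [Finset.mem_Ico, Finset.mem_filter, Finset.mem_range]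
    omega
  rw [← Finset.sum_filter, hI, Finset.sum_Ico_eq_sum_range]
  refine Finset.sum_congr rfl fun j _ => ?_
  rw [Nat.add_sub_cancel_left, add_comm q j]

theorem rightExpansion_leftSylvEntry (f : SkewPoly δ) (p : ℕ) :
    RightExpansion (f * (X δ) ^ p) (f.leftSylvEntry p) (f.natDegree + 1 + p) := by
  rw [show f.leftSylvEntry p = _ from funext fun q => f.leftSylvEntry_eq_wordConv p q]
  exact f.rightExpansion_rcoeff.mul_X_pow p

end Expansions

end SkewPoly

namespace SkewPoly

variable {F : Type u} [DivisionRing F] {σ : F ≃+* F} {δ : SkewDerivation σ}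

/-! ### Resultants and nontrivial linear relations -/

section Resultants

theorem coeff_mul_eq_zero {f g : SkewPoly δ} {m n k : ℕ} (hf : ∀ k, m < k → f.coeff k = 0)
    (hg : ∀ k, n < k → g.coeff k = 0) (hk : m + n < k) : (f * g).coeff k = 0 :=
  (coeff_mul_top hf hg).1 k hk

/-- The skew polynomial `∑ wᵢ xⁱ`. -/
noncomputable def ofLeftCoeffs (δ : SkewDerivation σ) {n : ℕ} (w : Fin n → F) : SkewPoly δ :=
  ∑ i : Fin n, C δ (w i) * (X δ) ^ (i : ℕ)

/-- The skew polynomial `∑ xⁱ wᵢ`. -/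
noncomputable def ofRightCoeffs (δ : SkewDerivation σ) {n : ℕ} (w : Fin n → F) : SkewPoly δ :=
  ∑ i : Fin n, (X δ) ^ (i : ℕ) * C δ (w i)

theorem coeff_ofLeftCoeffs {n : ℕ} (w : Fin n → F) (k : ℕ) :
    (ofLeftCoeffs δ w).coeff k = if h : k < n then w ⟨k, h⟩ else 0 := by
  simp only [ofLeftCoeffs, coeff_sum, C_mul_X_pow, coeff_mono]
  split_ifs with h
  · rw [Finset.sum_eq_single ⟨k, h⟩]
    · simp
    · intro i _ hi
      exact if_neg fun hik => hi (Fin.ext hik)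
    · simp
  · exact Finset.sum_eq_zero fun i _ => if_neg (by have := i.2; omega)

theorem ofLeftCoeffs_degree_lt {n : ℕ} (w : Fin n → F) : (ofLeftCoeffs δ w).degree < n :=
  degree_lt_iff.2 fun k hk => by rw [coeff_ofLeftCoeffs, dif_neg (by omega)]

theorem ofLeftCoeffs_eq_zero {n : ℕ} {w : Fin n → F} (h : ofLeftCoeffs δ w = 0) : w = 0 := by
  funext i
  have := coeff_ofLeftCoeffs (δ := δ) w i
  rw [h, dif_pos i.2] at this
  exact this.symm

theorem exists_ofLeftCoeffs_eq {n : ℕ} {f : SkewPoly δ} (hf : f.degree < n) :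
    ∃ w : Fin n → F, ofLeftCoeffs δ w = f := by
  refine ⟨fun i => f.coeff i, ?_⟩
  conv_rhs => rw [eq_sum_C_mul_X_pow f (degree_lt_iff.1 hf), Finset.sum_range]
  rfl

theorem rightExpansion_ofRightCoeffs {n : ℕ} (w : Fin n → F) :
    RightExpansion (ofRightCoeffs δ w) (fun k => if h : k < n then w ⟨k, h⟩ else 0) n := by
  refine ⟨?_, fun q hq => dif_neg (not_lt.2 hq)⟩
  rw [Finset.sum_range]
  exact Finset.sum_congr rfl fun i _ => by rw [dif_pos i.2]

theorem ofRightCoeffs_degree_lt {n : ℕ} (w : Fin n → F) : (ofRightCoeffs δ w).degree < n := by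
  refine degree_lt_iff.2 fun k hk => ?_
  rw [ofRightCoeffs, coeff_sum]
  refine Finset.sum_eq_zero fun i _ => coeff_mul_eq_zero (m := i) (n := 0) (fun l hl => ?_)
    (fun l hl => by rw [coeff_C, if_neg hl.ne]) (by have := i.2; omega)
  rw [X_pow, coeff_mono, if_neg hl.ne]

theorem ofRightCoeffs_eq_zero {n : ℕ} {w : Fin n → F} (h : ofRightCoeffs δ w = 0) : w = 0 := by
  funext i
  have h1 := rightExpansion_ofRightCoeffs (δ := δ) w
  rw [h] at h1
  simpa using h1.eq_zero_of_zero i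

theorem exists_ofRightCoeffs_eq {n : ℕ} {f : SkewPoly δ} (hf : f.degree < n) :
    ∃ w : Fin n → F, ofRightCoeffs δ w = f := by
  -- Zero is separate because its `natDegree` is `0`: the general expansion would have length `1`,
  -- too long for `n = 0`.
  by_cases h0 : f = 0
  · exact ⟨0, by simp [h0, ofRightCoeffs, C_zero]⟩
  · rw [degree_eq_natDegree h0] at hf
    have h1 := f.rightExpansion_rcoeff.mono_right (N' := n) (by exact_mod_cast hf)
    refine ⟨fun i => f.rcoeff i, ?_⟩
    conv_rhs => rw [h1.eq_sum, Finset.sum_range]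
    rfl

/-- The right resultant vanishes iff `c f + d g = 0` has a nontrivial solution with
`deg c < deg g` and `deg d < deg f`. -/
theorem rightResultant_eq_zero_iff (f g : SkewPoly δ) :
    rightResultant f g = 0 ↔ ∃ c d : SkewPoly δ, (c ≠ 0 ∨ d ≠ 0) ∧ c.degree < g.natDegree ∧
      d.degree < f.natDegree ∧ c * f + d * g = 0 := by
  have key : ∀ v : Fin (g.natDegree + f.natDegree) → F,
      Matrix.vecMul v (rightSylvester f g) = 0 ↔
        ofLeftCoeffs δ (fun i => v (Fin.castAdd _ i)) * f +
          ofLeftCoeffs δ (fun i => v (Fin.natAdd _ i)) * g = 0 := by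
    intro v
    have hc : ∀ q, (ofLeftCoeffs δ (fun i => v (Fin.castAdd _ i)) * f +
        ofLeftCoeffs δ (fun i => v (Fin.natAdd _ i)) * g).coeff q =
        ∑ i : Fin g.natDegree, v (Fin.castAdd _ i) * f.sylvEntry i q +
          ∑ i : Fin f.natDegree, v (Fin.natAdd _ i) * g.sylvEntry i q := by
      intro q
      simp only [ofLeftCoeffs, coeff_add, Finset.sum_mul, coeff_sum, mul_assoc]
      simp only [C_mul, coeff_smul, coeff_X_pow_mul]
    have hA : ∀ q : Fin (g.natDegree + f.natDegree), Matrix.vecMul v (rightSylvester f g) q =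
        ∑ i : Fin g.natDegree, v (Fin.castAdd _ i) * f.sylvEntry i q +
          ∑ i : Fin f.natDegree, v (Fin.natAdd _ i) * g.sylvEntry i q := by
      intro q
      simp [Matrix.vecMul, dotProduct, Fin.sum_univ_add, rightSylvester]
    constructor
    · intro h
      refine ext' fun q => ?_
      rw [coeff_zero]
      by_cases hq : q < g.natDegree + f.natDegree
      · rw [hc, ← hA ⟨q, hq⟩, h]
        rfl
      · have h1 := degree_lt_iff.1 (ofLeftCoeffs_degree_lt (δ := δ)
          fun i : Fin g.natDegree => v (Fin.castAdd _ i))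
        have h2 := degree_lt_iff.1 (ofLeftCoeffs_degree_lt (δ := δ)
          fun i : Fin f.natDegree => v (Fin.natAdd _ i))
        -- Columns beyond the matrix carry no condition, for degree reasons. The bound is strict in
        -- the degree of `c`, so that `n = 0`, where `c` vanishes, is covered.
        have aux : ∀ {c e : SkewPoly δ} {n : ℕ}, (∀ k, n ≤ k → c.coeff k = 0) →
            n + e.natDegree ≤ q → (c * e).coeff q = 0 := by
          intro c e n hcn hn
          rcases n with _ | n
          · rw [show c = 0 from ext' fun k => hcn k (Nat.zero_le k), zero_mul, coeff_zero]
          · exact coeff_mul_eq_zero (m := n) (fun k hk => hcn k hk)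
              (fun k hk => coeff_eq_zero_of_natDegree_lt hk) (by omega)
        rw [coeff_add, aux h1 (by omega), aux h2 (by omega), add_zero]
    · intro h
      funext q
      rw [hA, ← hc, h]
      rfl
  rw [rightResultant, dieudonneDet_eq_zero_iff_vecMul]
  constructor
  · rintro ⟨v, hv, hv0⟩
    refine ⟨_, _, ?_, ofLeftCoeffs_degree_lt _, ofLeftCoeffs_degree_lt _, (key v).1 hv0⟩
    by_contra! h
    refine hv (funext fun i => ?_)
    refine Fin.addCases (fun i => ?_) (fun i => ?_) i
    · exact congrFun (ofLeftCoeffs_eq_zero h.1) i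
    · exact congrFun (ofLeftCoeffs_eq_zero h.2) i
  · rintro ⟨c, d, hne, hc, hd, h⟩
    obtain ⟨w, rfl⟩ := exists_ofLeftCoeffs_eq hc
    obtain ⟨z, rfl⟩ := exists_ofLeftCoeffs_eq hd
    refine ⟨Fin.append w z, fun h0 => ?_, (key _).2 (by simpa using h)⟩
    have hw : w = 0 := funext fun i => by simpa using congrFun h0 (Fin.castAdd _ i)
    have hz : z = 0 := funext fun i => by simpa using congrFun h0 (Fin.natAdd _ i)
    rw [hw, hz] at hne
    simp [ofLeftCoeffs, C_zero] at hne

/-- The left resultant vanishes iff `f c + g d = 0` has a nontrivial solution with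
`deg c < deg g` and `deg d < deg f`. -/
theorem leftResultant_eq_zero_iff (f g : SkewPoly δ) :
    leftResultant f g = 0 ↔ ∃ c d : SkewPoly δ, (c ≠ 0 ∨ d ≠ 0) ∧ c.degree < g.natDegree ∧
      d.degree < f.natDegree ∧ f * c + g * d = 0 := by
  have key : ∀ v : Fin (g.natDegree + f.natDegree) → F,
      (leftSylvester f g).mulVec v = 0 ↔
        f * ofRightCoeffs δ (fun i => v (Fin.castAdd _ i)) +
          g * ofRightCoeffs δ (fun i => v (Fin.natAdd _ i)) = 0 := by
    intro v
    -- Constants multiply on the right, so the right-hand coefficients of the combination are the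
    -- entries of a matrix acting on column vectors; `eq_zero_of_zero` then makes the system
    -- equivalent to the relation.
    have hE : RightExpansion (f * ofRightCoeffs δ (fun i => v (Fin.castAdd _ i)) +
        g * ofRightCoeffs δ (fun i => v (Fin.natAdd _ i)))
        (fun q => ∑ i : Fin g.natDegree, f.leftSylvEntry i q * v (Fin.castAdd _ i) +
          ∑ i : Fin f.natDegree, g.leftSylvEntry i q * v (Fin.natAdd _ i))
        (g.natDegree + f.natDegree) := by
      simp only [ofRightCoeffs, Finset.mul_sum, ← mul_assoc]
      refine RightExpansion.add (RightExpansion.sum _ fun i _ => ?_)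
        (RightExpansion.sum _ fun i _ => ?_)
      · exact ((f.rightExpansion_leftSylvEntry i).mul_C _).mono_right (by have := i.2; omega)
      · exact ((g.rightExpansion_leftSylvEntry i).mul_C _).mono_right (by have := i.2; omega)
    have hA : ∀ q : Fin (g.natDegree + f.natDegree), (leftSylvester f g).mulVec v q =
        ∑ i : Fin g.natDegree, f.leftSylvEntry i q * v (Fin.castAdd _ i) +
          ∑ i : Fin f.natDegree, g.leftSylvEntry i q * v (Fin.natAdd _ i) := by
      intro q
      simp [Matrix.mulVec, dotProduct, Fin.sum_univ_add, leftSylvester]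
    constructor
    · intro h
      rw [hE.eq_sum, Finset.sum_range]
      refine Finset.sum_eq_zero fun q _ => ?_
      rw [← hA, h, Pi.zero_apply, C_zero, mul_zero]
    · intro h
      rw [h] at hE
      funext q
      rw [hA]
      exact hE.eq_zero_of_zero q
  rw [leftResultant, dieudonneDet_eq_zero_iff_mulVec]
  constructor
  · rintro ⟨v, hv, hv0⟩
    refine ⟨_, _, ?_, ofRightCoeffs_degree_lt _, ofRightCoeffs_degree_lt _, (key v).1 hv0⟩
    by_contra! h
    refine hv (funext fun i => ?_)
    refine Fin.addCases (fun i => ?_) (fun i => ?_) i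
    · exact congrFun (ofRightCoeffs_eq_zero h.1) i
    · exact congrFun (ofRightCoeffs_eq_zero h.2) i
  · rintro ⟨c, d, hne, hc, hd, h⟩
    obtain ⟨w, rfl⟩ := exists_ofRightCoeffs_eq hc
    obtain ⟨z, rfl⟩ := exists_ofRightCoeffs_eq hd
    refine ⟨Fin.append w z, fun h0 => ?_, (key _).2 (by simpa using h)⟩
    have hw : w = 0 := funext fun i => by simpa using congrFun h0 (Fin.castAdd _ i)
    have hz : z = 0 := funext fun i => by simpa using congrFun h0 (Fin.natAdd _ i)
    rw [hw, hz] at hne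
    simp [ofRightCoeffs, C_zero] at hne

end Resultants

end SkewPoly

namespace SkewPoly

variable {F : Type u} [DivisionRing F] {σ : F ≃+* F} {δ : SkewDerivation σ}

/-! ### Degrees of products -/

section Degrees

/-- The leading coefficient of the product is that of `f` times `σ^{deg f}` of that of `g`, and `σ`
is injective. -/
theorem mul_ne_zero_natDegree {f g : SkewPoly δ} (hf : f ≠ 0) (hg : g ≠ 0) :
    f * g ≠ 0 ∧ (f * g).natDegree = f.natDegree + g.natDegree := by
  have ht := coeff_mul_top (natDegree_le_iff.1 (le_refl f.natDegree))
    (natDegree_le_iff.1 (le_refl g.natDegree))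
  have hne : (f * g).coeff (f.natDegree + g.natDegree) ≠ 0 := by
    rw [ht.2]
    exact mul_ne_zero (coeff_natDegree_ne_zero hf)
      (iterate_sigma_ne_zero (coeff_natDegree_ne_zero hg) _)
  refine ⟨fun h => hne (by rw [h, coeff_zero]), le_antisymm (natDegree_le_iff.2 ht.1) ?_⟩
  by_contra hlt
  exact hne (coeff_eq_zero_of_natDegree_lt (not_le.1 hlt))

theorem mul_ne_zero' {f g : SkewPoly δ} (hf : f ≠ 0) (hg : g ≠ 0) : f * g ≠ 0 :=
  (mul_ne_zero_natDegree hf hg).1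

theorem natDegree_mul' {f g : SkewPoly δ} (hf : f ≠ 0) (hg : g ≠ 0) :
    (f * g).natDegree = f.natDegree + g.natDegree :=
  (mul_ne_zero_natDegree hf hg).2

theorem natDegree_zero : (0 : SkewPoly δ).natDegree = 0 := Polynomial.natDegree_zero (R := F)

theorem natDegree_C (a : F) : (C δ a).natDegree = 0 := Polynomial.natDegree_C (R := F) a

theorem C_one : C δ (1 : F) = 1 := rfl

theorem natDegree_one : (1 : SkewPoly δ).natDegree = 0 := natDegree_C 1

theorem one_ne_zero' : (1 : SkewPoly δ) ≠ 0 := fun h => by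
  have := congrArg (fun g => g.coeff 0) h
  rw [← C_one] at this
  simp [coeff_C] at this

theorem natDegree_pos_ne_zero {f : SkewPoly δ} (h : 0 < f.natDegree) : f ≠ 0 := by
  rintro rfl
  rw [natDegree_zero] at h
  exact lt_irrefl _ h

theorem eq_C_of_natDegree_eq_zero {f : SkewPoly δ} (h : f.natDegree = 0) :
    f = C δ (f.coeff 0) := by
  refine ext' fun k => ?_
  rw [coeff_C]
  split_ifs with hk
  · rw [hk]
  · exact coeff_eq_zero_of_natDegree_lt (by omega)

theorem C_ne_zero {c : F} (hc : c ≠ 0) : C δ c ≠ 0 := fun h => hc (by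
  have := congrArg (fun g => g.coeff 0) h
  simpa [coeff_C] using this)

theorem coeff_X_sub_C (a : F) (k : ℕ) :
    (X δ - C δ a).coeff k = (if 1 = k then 1 else 0) - if 0 = k then a else 0 := by
  rw [coeff_sub, X, coeff_mono, coeff_C]

theorem natDegree_X_sub_C (a : F) : (X δ - C δ a).natDegree = 1 := by
  refine le_antisymm (natDegree_le_iff.2 fun k hk => ?_) ?_
  · rw [coeff_X_sub_C, if_neg hk.ne, if_neg (by omega), sub_zero]
  · by_contra h
    have := coeff_eq_zero_of_natDegree_lt (not_le.1 h)
    rw [coeff_X_sub_C] at this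
    simp at this

theorem X_sub_C_ne_zero (a : F) : X δ - C δ a ≠ 0 :=
  natDegree_pos_ne_zero (by rw [natDegree_X_sub_C]; exact one_pos)

theorem degree_lt_iff_of_ne_zero {r g : SkewPoly δ} (hg : g ≠ 0) :
    r.degree < g.degree ↔ ∀ k, g.natDegree ≤ k → r.coeff k = 0 := by
  rw [degree_eq_natDegree hg, degree_lt_iff]

theorem natDegree_add_C (f : SkewPoly δ) (c : F) :
    (f + C δ c).natDegree = f.natDegree :=
  Polynomial.natDegree_add_C (R := F) (p := (f : F[X])) (a := c)

end Degrees

/-! ### Uniqueness of division, divisibility and roots -/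

section Division

theorem rightQuot_mul_add_rightRem (f g : SkewPoly δ) :
    f = rightQuot f g * g + rightRem f g := by
  rw [rightRem, add_sub_cancel]

theorem mul_leftQuot_add_leftRem (f g : SkewPoly δ) :
    f = g * leftQuot f g + leftRem f g := by
  rw [leftRem, add_sub_cancel]

theorem rightQuot_rightRem_eq {f g q r : SkewPoly δ} (hg : g ≠ 0) (h : f = q * g + r)
    (hr : r.degree < g.degree) : rightQuot f g = q ∧ rightRem f g = r :=
  right_division_unique ((rightQuot_mul_add_rightRem f g).symm.trans h)
    (rightRem_degree_lt f hg) hr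

theorem leftQuot_leftRem_eq {f g q r : SkewPoly δ} (hg : g ≠ 0) (h : f = g * q + r)
    (hr : r.degree < g.degree) : leftQuot f g = q ∧ leftRem f g = r :=
  left_division_unique ((mul_leftQuot_add_leftRem f g).symm.trans h)
    (leftRem_degree_lt f hg) hr

theorem zero_degree_lt {g : SkewPoly δ} (hg : g ≠ 0) : (0 : SkewPoly δ).degree < g.degree :=
  (degree_lt_iff_of_ne_zero hg).2 fun k _ => coeff_zero k

theorem rightDvd_iff_rightRem {f g : SkewPoly δ} (hg : g ≠ 0) :
    RightDvd g f ↔ rightRem f g = 0 := by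
  constructor
  · rintro ⟨q, hq⟩
    exact (rightQuot_rightRem_eq hg (by rw [add_zero]; exact hq) (zero_degree_lt hg)).2
  · intro h
    refine ⟨rightQuot f g, ?_⟩
    conv_lhs => rw [rightQuot_mul_add_rightRem f g, h, add_zero]

theorem leftDvd_iff_leftRem {f g : SkewPoly δ} (hg : g ≠ 0) :
    LeftDvd g f ↔ leftRem f g = 0 := by
  constructor
  · rintro ⟨q, hq⟩
    exact (leftQuot_leftRem_eq hg (by rw [add_zero]; exact hq) (zero_degree_lt hg)).2
  · intro h
    refine ⟨leftQuot f g, ?_⟩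
    conv_lhs => rw [mul_leftQuot_add_leftRem f g, h, add_zero]

theorem eq_C_of_degree_lt_X_sub_C {r : SkewPoly δ} {a : F} (h : r.degree < (X δ - C δ a).degree) :
    r = C δ (r.coeff 0) := by
  rw [degree_lt_iff_of_ne_zero (X_sub_C_ne_zero a), natDegree_X_sub_C] at h
  exact eq_C_of_natDegree_eq_zero (Nat.le_zero.1 (natDegree_le_iff.2 fun k hk => h k hk))

theorem rightRem_X_sub_C (f : SkewPoly δ) (a : F) :
    rightRem f (X δ - C δ a) = C δ (f.rightEval a) :=
  eq_C_of_degree_lt_X_sub_C (rightRem_degree_lt f (X_sub_C_ne_zero a))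

theorem leftRem_X_sub_C (f : SkewPoly δ) (a : F) :
    leftRem f (X δ - C δ a) = C δ (f.leftEval a) :=
  eq_C_of_degree_lt_X_sub_C (leftRem_degree_lt f (X_sub_C_ne_zero a))

theorem rightEval_eq_zero_iff (f : SkewPoly δ) (a : F) :
    f.rightEval a = 0 ↔ RightDvd (X δ - C δ a) f := by
  rw [rightDvd_iff_rightRem (X_sub_C_ne_zero a), rightRem_X_sub_C]
  exact ⟨fun h => by rw [h, C_zero], fun h => by_contra fun hne => C_ne_zero hne h⟩

theorem leftEval_eq_zero_iff (f : SkewPoly δ) (a : F) :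
    f.leftEval a = 0 ↔ LeftDvd (X δ - C δ a) f := by
  rw [leftDvd_iff_leftRem (X_sub_C_ne_zero a), leftRem_X_sub_C]
  exact ⟨fun h => by rw [h, C_zero], fun h => by_contra fun hne => C_ne_zero hne h⟩

end Division

/-! ### Resultant and greatest common divisor across one linear division -/

section ConstantRemainder

variable {g h : SkewPoly δ} {a c : F}

theorem natDegree_of_eq_mul_X_sub_C_add (hg : 0 < g.natDegree)
    (e : g = h * (X δ - C δ a) + C δ c) : g.natDegree = h.natDegree + 1 := by
  have h0 : h ≠ 0 := by
    rintro rfl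
    rw [e, zero_mul, zero_add, natDegree_C] at hg
    exact lt_irrefl _ hg
  have h1 := natDegree_mul' h0 (X_sub_C_ne_zero a)
  rw [natDegree_X_sub_C] at h1
  rw [e, natDegree_add_C, h1]

theorem natDegree_of_eq_X_sub_C_mul_add (hg : 0 < g.natDegree)
    (e : g = (X δ - C δ a) * h + C δ c) : g.natDegree = h.natDegree + 1 := by
  have h0 : h ≠ 0 := by
    rintro rfl
    rw [e, mul_zero, zero_add, natDegree_C] at hg
    exact lt_irrefl _ hg
  have h1 := natDegree_mul' (X_sub_C_ne_zero a) h0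
  rw [natDegree_X_sub_C] at h1
  rw [e, natDegree_add_C, h1, add_comm]

/-- A relation `g p + h q = 0` becomes `h ((x - a) p + q) = -c p`. If `c` and `p` are nonzero, the
left side has degree at least `deg h`, the right side degree `deg p < deg h`. -/
theorem leftResultant_eq_zero_iff_of_eq (hg : 1 < g.natDegree)
    (e : g = h * (X δ - C δ a) + C δ c) : leftResultant g h = 0 ↔ c = 0 := by
  have hdeg := natDegree_of_eq_mul_X_sub_C_add (by omega) e
  have h0 : h ≠ 0 := natDegree_pos_ne_zero (by omega)
  rw [leftResultant_eq_zero_iff]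
  constructor
  · rintro ⟨p, q, hne, hp, -, hpq⟩
    by_contra hc
    have h1 : h * ((X δ - C δ a) * p + q) = -(C δ c * p) := by
      rw [eq_neg_iff_add_eq_zero, ← hpq]
      conv_rhs => rw [e]
      noncomm_ring
    have hp0 : p = 0 := by
      by_contra hp0
      have h2 : (X δ - C δ a) * p + q ≠ 0 := by
        intro h2
        rw [h2, mul_zero, eq_comm, neg_eq_zero] at h1
        exact mul_ne_zero' (C_ne_zero hc) hp0 h1
      have h3 := natDegree_mul' h0 h2
      have h4 : (-(C δ c * p)).natDegree = p.natDegree := by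
        rw [show -(C δ c * p) = C δ (-c) * p by rw [C_neg, neg_mul],
          natDegree_mul' (C_ne_zero (neg_ne_zero.2 hc)) hp0, natDegree_C, zero_add]
      rw [h1, h4] at h3
      rw [degree_eq_natDegree hp0] at hp
      have : p.natDegree < h.natDegree := by exact_mod_cast hp
      omega
    rw [hp0, mul_zero, zero_add] at hpq
    have hq0 : q = 0 := by
      by_contra hq0
      exact mul_ne_zero' h0 hq0 hpq
    simp [hp0, hq0] at hne
  · rintro rfl
    rw [C_zero, add_zero] at e
    -- The relation is `g = h (x - a)` itself. The constant `1` is admissible since `deg g > 1`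
    -- gives `deg h > 0`, and `x - a` since `1 < deg g`.
    refine ⟨1, -(X δ - C δ a), Or.inl one_ne_zero', ?_, ?_, ?_⟩
    · rw [degree_eq_natDegree one_ne_zero', natDegree_one]
      exact_mod_cast (by omega : 0 < h.natDegree)
    · refine degree_lt_iff.2 fun k hk => ?_
      rw [neg_sub, coeff_sub, X, coeff_mono, coeff_C, if_neg (by omega), if_neg (by omega),
        sub_zero]
    · rw [mul_one, mul_neg, e, add_neg_cancel]

/-- Mirror image: the relation becomes `(p (x - a) + q) h = -p c`, with the same comparison of
degrees. -/
theorem rightResultant_eq_zero_iff_of_eq (hg : 1 < g.natDegree)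
    (e : g = (X δ - C δ a) * h + C δ c) : rightResultant g h = 0 ↔ c = 0 := by
  have hdeg := natDegree_of_eq_X_sub_C_mul_add (by omega) e
  have h0 : h ≠ 0 := natDegree_pos_ne_zero (by omega)
  rw [rightResultant_eq_zero_iff]
  constructor
  · rintro ⟨p, q, hne, hp, -, hpq⟩
    by_contra hc
    have h1 : (p * (X δ - C δ a) + q) * h = -(p * C δ c) := by
      rw [eq_neg_iff_add_eq_zero, ← hpq]
      conv_rhs => rw [e]
      noncomm_ring
    have hp0 : p = 0 := by
      by_contra hp0
      have h2 : p * (X δ - C δ a) + q ≠ 0 := by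
        intro h2
        rw [h2, zero_mul, eq_comm, neg_eq_zero] at h1
        exact mul_ne_zero' hp0 (C_ne_zero hc) h1
      have h3 := natDegree_mul' h2 h0
      have h4 : (-(p * C δ c)).natDegree = p.natDegree := by
        rw [show -(p * C δ c) = p * C δ (-c) by rw [C_neg, mul_neg],
          natDegree_mul' hp0 (C_ne_zero (neg_ne_zero.2 hc)), natDegree_C, add_zero]
      rw [h1, h4] at h3
      rw [degree_eq_natDegree hp0] at hp
      have : p.natDegree < h.natDegree := by exact_mod_cast hp
      omega
    rw [hp0, zero_mul, zero_add] at hpq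
    have hq0 : q = 0 := by
      by_contra hq0
      exact mul_ne_zero' hq0 h0 hpq
    simp [hp0, hq0] at hne
  · rintro rfl
    rw [C_zero, add_zero] at e
    refine ⟨1, -(X δ - C δ a), Or.inl one_ne_zero', ?_, ?_, ?_⟩
    · rw [degree_eq_natDegree one_ne_zero', natDegree_one]
      exact_mod_cast (by omega : 0 < h.natDegree)
    · refine degree_lt_iff.2 fun k hk => ?_
      rw [neg_sub, coeff_sub, X, coeff_mono, coeff_C, if_neg (by omega), if_neg (by omega),
        sub_zero]
    · rw [one_mul, neg_mul, e, add_neg_cancel]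

theorem isGcld_gcld {f g : SkewPoly δ} (h : f ≠ 0 ∨ g ≠ 0) : IsGcld f g (gcld f g) := by
  rw [gcld, dif_pos h]
  exact (exists_isGcld f g h).choose_spec

theorem isGcrd_gcrd {f g : SkewPoly δ} (h : f ≠ 0 ∨ g ≠ 0) : IsGcrd f g (gcrd f g) := by
  rw [gcrd, dif_pos h]
  exact (exists_isGcrd f g h).choose_spec

theorem IsMonic.eq_one {d : SkewPoly δ} (hd : IsMonic d) (h : d.natDegree = 0) : d = 1 := by
  rw [IsMonic, h] at hd
  rw [eq_C_of_natDegree_eq_zero h, hd, C_one]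

/-- The constant `c = g - h (x - a)` is a right multiple of every common left divisor, so a nonzero
`c` leaves only constant ones. -/
theorem gcld_ne_one_iff_of_eq (hg : 1 < g.natDegree)
    (e : g = h * (X δ - C δ a) + C δ c) : gcld g h ≠ 1 ↔ c = 0 := by
  have hdeg := natDegree_of_eq_mul_X_sub_C_add (by omega) e
  have h0 : h ≠ 0 := natDegree_pos_ne_zero (by omega)
  have hd := isGcld_gcld (f := g) (Or.inr h0)
  constructor
  · intro hne
    by_contra hc
    obtain ⟨s, hs⟩ := hd.dvd_left
    obtain ⟨t, ht⟩ := hd.dvd_right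
    have h1 : C δ c = gcld g h * (s - t * (X δ - C δ a)) := by
      rw [mul_sub, ← hs, ← mul_assoc, ← ht, eq_sub_iff_add_eq', ← e]
    have hn := C_ne_zero (δ := δ) hc
    rw [h1] at hn
    have h2 := natDegree_mul' (left_ne_zero_of_mul hn) (right_ne_zero_of_mul hn)
    rw [← h1, natDegree_C] at h2
    exact hne (hd.monic.eq_one (by omega))
  · rintro rfl h1
    rw [C_zero, add_zero] at e
    -- For `c = 0` the nonconstant `h` divides both and hence would divide `1`.
    obtain ⟨s, hs⟩ := hd.greatest h ⟨_, e⟩ ⟨1, (mul_one h).symm⟩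
    rw [h1] at hs
    have hn : h * s ≠ 0 := hs ▸ one_ne_zero'
    have h2 := natDegree_mul' h0 (right_ne_zero_of_mul hn)
    rw [← hs, natDegree_one] at h2
    omega

theorem gcrd_ne_one_iff_of_eq (hg : 1 < g.natDegree)
    (e : g = (X δ - C δ a) * h + C δ c) : gcrd g h ≠ 1 ↔ c = 0 := by
  have hdeg := natDegree_of_eq_X_sub_C_mul_add (by omega) e
  have h0 : h ≠ 0 := natDegree_pos_ne_zero (by omega)
  have hd := isGcrd_gcrd (f := g) (Or.inr h0)
  constructor
  · intro hne
    by_contra hc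
    obtain ⟨s, hs⟩ := hd.dvd_left
    obtain ⟨t, ht⟩ := hd.dvd_right
    have h1 : C δ c = (s - (X δ - C δ a) * t) * gcrd g h := by
      rw [sub_mul, ← hs, mul_assoc, ← ht, eq_sub_iff_add_eq', ← e]
    have hn := C_ne_zero (δ := δ) hc
    rw [h1] at hn
    have h2 := natDegree_mul' (left_ne_zero_of_mul hn) (right_ne_zero_of_mul hn)
    rw [← h1, natDegree_C] at h2
    exact hne (hd.monic.eq_one (by omega))
  · rintro rfl h1
    rw [C_zero, add_zero] at e
    obtain ⟨s, hs⟩ := hd.greatest h ⟨_, e⟩ ⟨1, (one_mul h).symm⟩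
    rw [h1] at hs
    have hn : s * h ≠ 0 := hs ▸ one_ne_zero'
    have h2 := natDegree_mul' (left_ne_zero_of_mul hn) h0
    rw [← hs, natDegree_one] at h2
    omega

end ConstantRemainder

/-! ### Recursion for the derivative polynomials -/

section Derivatives

theorem rightP_zero (a : Fin 0 → F) : rightP δ a = 1 := by simp [rightP]

theorem leftP_zero (a : Fin 0 → F) : leftP δ a = 1 := by simp [leftP]

theorem rightP_succ {n : ℕ} (a : Fin (n + 1) → F) :
    rightP δ a = (X δ - C δ (a (Fin.last n))) * rightP δ (fun i : Fin n => a i.castSucc) := by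
  rw [rightP, List.ofFn_succ', List.concat_eq_append]
  simp [rightP]

theorem leftP_succ {n : ℕ} (a : Fin (n + 1) → F) :
    leftP δ a = leftP δ (fun i : Fin n => a i.castSucc) * (X δ - C δ (a (Fin.last n))) := by
  rw [leftP, List.ofFn_succ', List.concat_eq_append]
  simp [leftP]

theorem rightP_ne_zero : ∀ {n : ℕ} (a : Fin n → F), rightP δ a ≠ 0
  | 0, a => by rw [rightP_zero]; exact one_ne_zero'
  | n + 1, a => by rw [rightP_succ]; exact mul_ne_zero' (X_sub_C_ne_zero _) (rightP_ne_zero _)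

theorem leftP_ne_zero : ∀ {n : ℕ} (a : Fin n → F), leftP δ a ≠ 0
  | 0, a => by rw [leftP_zero]; exact one_ne_zero'
  | n + 1, a => by rw [leftP_succ]; exact mul_ne_zero' (leftP_ne_zero _) (X_sub_C_ne_zero _)

theorem rightDeriv_zero (f : SkewPoly δ) (a : Fin 0 → F) : f.rightDeriv a = f := by
  rw [rightDeriv, rightP_zero]
  exact (rightQuot_rightRem_eq one_ne_zero' (by rw [mul_one, add_zero])
    (zero_degree_lt one_ne_zero')).1

theorem leftDeriv_zero (f : SkewPoly δ) (a : Fin 0 → F) : f.leftDeriv a = f := by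
  rw [leftDeriv, leftP_zero]
  exact (leftQuot_leftRem_eq one_ne_zero' (by rw [one_mul, add_zero])
    (zero_degree_lt one_ne_zero')).1

variable {n : ℕ} (f : SkewPoly δ) (a : Fin (n + 1) → F)

/-- Consecutive right derivative polynomials differ by a right division by `x - a_{n+1}`. -/
theorem rightDeriv_castSucc :
    f.rightDeriv (fun i : Fin n => a i.castSucc) =
      f.rightDeriv a * (X δ - C δ (a (Fin.last n))) +
        C δ ((f.rightDeriv fun i : Fin n => a i.castSucc).rightEval (a (Fin.last n))) := by
  set b := fun i : Fin n => a i.castSucc with hb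
  set g := f.rightDeriv b with hg
  set y := X δ - C δ (a (Fin.last n)) with hy
  have hP := rightP_ne_zero (δ := δ) b
  have hyP : y * rightP δ b ≠ 0 := mul_ne_zero' (X_sub_C_ne_zero _) hP
  have h1 := rightQuot_mul_add_rightRem g y
  rw [hy, rightRem_X_sub_C, ← hy] at h1
  -- Dividing `g` by `y` inside `f = g P_b + ρ` gives the remainder `c P_b + ρ`, whose degree is
  -- below that of `y P_b`; uniqueness of division identifies the quotient.
  have h2 : f = rightQuot g y * (y * rightP δ b) +
      (C δ (g.rightEval (a (Fin.last n))) * rightP δ b + rightRem f (rightP δ b)) := by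
    rw [← add_assoc, ← mul_assoc, ← add_mul, ← h1]
    exact rightQuot_mul_add_rightRem f _
  have h3 : f.rightDeriv a = rightQuot g y := by
    rw [rightDeriv, rightP_succ]
    refine (rightQuot_rightRem_eq hyP h2 ((degree_lt_iff_of_ne_zero hyP).2 fun k hk => ?_)).1
    rw [natDegree_mul' (X_sub_C_ne_zero _) hP, natDegree_X_sub_C] at hk
    rw [coeff_add, C_mul, coeff_smul, coeff_eq_zero_of_natDegree_lt (by omega), mul_zero,
      (degree_lt_iff_of_ne_zero hP).1 (rightRem_degree_lt f hP) k (by omega), add_zero]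
  rw [h3]
  exact h1

/-- Consecutive left derivative polynomials differ by a left division by `x - a_{n+1}`. -/
theorem leftDeriv_castSucc :
    f.leftDeriv (fun i : Fin n => a i.castSucc) =
      (X δ - C δ (a (Fin.last n))) * f.leftDeriv a +
        C δ ((f.leftDeriv fun i : Fin n => a i.castSucc).leftEval (a (Fin.last n))) := by
  set b := fun i : Fin n => a i.castSucc with hb
  set g := f.leftDeriv b with hg
  set y := X δ - C δ (a (Fin.last n)) with hy
  have hP := leftP_ne_zero (δ := δ) b
  have hyP : leftP δ b * y ≠ 0 := mul_ne_zero' hP (X_sub_C_ne_zero _)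
  have h1 := mul_leftQuot_add_leftRem g y
  rw [hy, leftRem_X_sub_C, ← hy] at h1
  have h2 : f = leftP δ b * y * leftQuot g y +
      (leftP δ b * C δ (g.leftEval (a (Fin.last n))) + leftRem f (leftP δ b)) := by
    rw [← add_assoc, mul_assoc, ← mul_add, ← h1]
    exact mul_leftQuot_add_leftRem f _
  have h3 : f.leftDeriv a = leftQuot g y := by
    rw [leftDeriv, leftP_succ]
    refine (leftQuot_leftRem_eq hyP h2 ((degree_lt_iff_of_ne_zero hyP).2 fun k hk => ?_)).1
    rw [natDegree_mul' hP (X_sub_C_ne_zero _), natDegree_X_sub_C] at hk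
    rw [coeff_add, coeff_mul_eq_zero (n := 0) (fun k hk => coeff_eq_zero_of_natDegree_lt hk)
      (fun k hk => coeff_eq_zero_of_natDegree_lt (by rwa [natDegree_C])) (by omega), zero_add,
      (degree_lt_iff_of_ne_zero hP).1 (leftRem_degree_lt f hP) k (by omega)]
  rw [h3]
  exact h1

/-- If `f = q (x - a_{n+1}) P` for the shorter product `P`, then `Δ f = q (x - a_{n+1})` by
uniqueness of division by `P`. Conversely, such a factorization of `Δ f` can be substituted into `f
= Δ f · P`. -/
theorem rightDvd_rightP_succ :
    RightDvd (rightP δ a) f ↔ RightDvd (rightP δ fun i : Fin n => a i.castSucc) f ∧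
      (f.rightDeriv fun i : Fin n => a i.castSucc).rightEval (a (Fin.last n)) = 0 := by
  have hP := rightP_ne_zero (δ := δ) fun i : Fin n => a i.castSucc
  rw [rightEval_eq_zero_iff, rightP_succ]
  constructor
  · rintro ⟨q, hq⟩
    rw [← mul_assoc] at hq
    refine ⟨⟨_, hq⟩, q, ?_⟩
    exact (rightQuot_rightRem_eq hP (by rw [add_zero]; exact hq) (zero_degree_lt hP)).1
  · rintro ⟨h, q, hq⟩
    rw [rightDvd_iff_rightRem hP] at h
    refine ⟨q, ?_⟩
    rw [← mul_assoc, ← hq]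
    simpa [h, rightDeriv] using rightQuot_mul_add_rightRem f (rightP δ fun i : Fin n => a i.castSucc)

theorem leftDvd_leftP_succ :
    LeftDvd (leftP δ a) f ↔ LeftDvd (leftP δ fun i : Fin n => a i.castSucc) f ∧
      (f.leftDeriv fun i : Fin n => a i.castSucc).leftEval (a (Fin.last n)) = 0 := by
  have hP := leftP_ne_zero (δ := δ) fun i : Fin n => a i.castSucc
  rw [leftEval_eq_zero_iff, leftP_succ]
  constructor
  · rintro ⟨q, hq⟩
    rw [mul_assoc] at hq
    refine ⟨⟨_, hq⟩, q, ?_⟩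
    exact (leftQuot_leftRem_eq hP (by rw [add_zero]; exact hq) (zero_degree_lt hP)).1
  · rintro ⟨h, q, hq⟩
    rw [leftDvd_iff_leftRem hP] at h
    refine ⟨q, ?_⟩
    rw [mul_assoc, ← hq]
    simpa [h, leftDeriv] using mul_leftQuot_add_leftRem f (leftP δ fun i : Fin n => a i.castSucc)

end Derivatives

/-! ### Multiplicity along the prefixes of the sequence -/

section Multiplicity

variable (f : SkewPoly δ) {r : ℕ} (a : Fin r → F)

/-- Induction on the length of the prefix: each further linear factor adds exactly one root
condition. -/
theorem rightDvd_rightP_take_iff : ∀ (n : ℕ) (hn : n ≤ r),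
    RightDvd (rightP δ (Fin.take n hn a)) f ↔ ∀ i : Fin r, (i : ℕ) < n →
      (f.rightDeriv (Fin.take i i.is_le' a)).rightEval (a i) = 0
  | 0, hn => by
    rw [rightP_zero]
    exact ⟨fun _ i hi => absurd hi (Nat.not_lt_zero _), fun _ => ⟨f, (mul_one f).symm⟩⟩
  | n + 1, hn => by
    refine (rightDvd_rightP_succ f (Fin.take (n + 1) hn a)).trans ?_
    refine (and_congr_left' (rightDvd_rightP_take_iff n (by omega))).trans ?_
    constructor
    · rintro ⟨h1, h2⟩ i hi
      rcases Nat.lt_succ_iff_lt_or_eq.1 hi with hi | hi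
      · exact h1 i hi
      · obtain rfl : i = ⟨n, hn⟩ := Fin.ext hi
        exact h2
    · exact fun h => ⟨fun i hi => h i (by omega), h ⟨n, hn⟩ n.lt_succ_self⟩

theorem leftDvd_leftP_take_iff : ∀ (n : ℕ) (hn : n ≤ r),
    LeftDvd (leftP δ (Fin.take n hn a)) f ↔ ∀ i : Fin r, (i : ℕ) < n →
      (f.leftDeriv (Fin.take i i.is_le' a)).leftEval (a i) = 0
  | 0, hn => by
    rw [leftP_zero]
    exact ⟨fun _ i hi => absurd hi (Nat.not_lt_zero _), fun _ => ⟨f, (one_mul f).symm⟩⟩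
  | n + 1, hn => by
    refine (leftDvd_leftP_succ f (Fin.take (n + 1) hn a)).trans ?_
    refine (and_congr_left' (leftDvd_leftP_take_iff n (by omega))).trans ?_
    constructor
    · rintro ⟨h1, h2⟩ i hi
      rcases Nat.lt_succ_iff_lt_or_eq.1 hi with hi | hi
      · exact h1 i hi
      · obtain rfl : i = ⟨n, hn⟩ := Fin.ext hi
        exact h2
    · exact fun h => ⟨fun i hi => h i (by omega), h ⟨n, hn⟩ n.lt_succ_self⟩

/-- The prefix of length `i` is definitionally the prefix of length `i + 1` without its last entry
`a i`, so the recursion applies as it stands. -/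
theorem rightDeriv_take (i : Fin r) :
    f.rightDeriv (Fin.take i i.is_le' a) =
      f.rightDeriv (Fin.take (i + 1) i.is_lt a) * (X δ - C δ (a i)) +
        C δ ((f.rightDeriv (Fin.take i i.is_le' a)).rightEval (a i)) :=
  rightDeriv_castSucc f (Fin.take (i + 1) i.is_lt a)

theorem leftDeriv_take (i : Fin r) :
    f.leftDeriv (Fin.take i i.is_le' a) =
      (X δ - C δ (a i)) * f.leftDeriv (Fin.take (i + 1) i.is_lt a) +
        C δ ((f.leftDeriv (Fin.take i i.is_le' a)).leftEval (a i)) :=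
  leftDeriv_castSucc f (Fin.take (i + 1) i.is_lt a)

/-- Dividing a nonconstant polynomial by a linear one lowers the degree by exactly one, and `r ≤ deg
f` keeps the degree positive before each of the `r` divisions. -/
theorem natDegree_rightDeriv_take (hr : r ≤ f.natDegree) : ∀ (n : ℕ) (hn : n ≤ r),
    (f.rightDeriv (Fin.take n hn a)).natDegree + n = f.natDegree
  | 0, hn => by rw [rightDeriv_zero, add_zero]
  | n + 1, hn => by
    have ih := natDegree_rightDeriv_take hr n (by omega)
    have := natDegree_of_eq_mul_X_sub_C_add (by simp only; omega) (rightDeriv_take f a ⟨n, hn⟩)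
    simp only at this
    omega

theorem natDegree_leftDeriv_take (hr : r ≤ f.natDegree) : ∀ (n : ℕ) (hn : n ≤ r),
    (f.leftDeriv (Fin.take n hn a)).natDegree + n = f.natDegree
  | 0, hn => by rw [leftDeriv_zero, add_zero]
  | n + 1, hn => by
    have ih := natDegree_leftDeriv_take hr n (by omega)
    have := natDegree_of_eq_X_sub_C_mul_add (by simp only; omega) (leftDeriv_take f a ⟨n, hn⟩)
    simp only at this
    omega

theorem right_multiplicity_tfae (hr : r < f.natDegree) :
    List.TFAE [
      f.IsRightRootVia a,
      ∀ i : Fin r, (f.rightDeriv (Fin.take i i.is_le' a)).rightEval (a i) = 0,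
      ∀ i : Fin r, SkewPoly.leftResultant (f.rightDeriv (Fin.take i i.is_le' a))
        (f.rightDeriv (Fin.take (i + 1) i.is_lt a)) = 0,
      ∀ i : Fin r, SkewPoly.gcld (f.rightDeriv (Fin.take i i.is_le' a))
        (f.rightDeriv (Fin.take (i + 1) i.is_lt a)) ≠ 1] := by
  -- The degree is `deg f - i` with `i < r < deg f`, hence at least `2`; the next derivative is then
  -- still nonconstant.
  have hdeg : ∀ i : Fin r, 1 < (f.rightDeriv (Fin.take i i.is_le' a)).natDegree := fun i => by
    have := natDegree_rightDeriv_take f a hr.le i i.is_le'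
    omega
  tfae_have 1 ↔ 2 := (rightDvd_rightP_take_iff f a r le_rfl).trans
    (forall_congr' fun i => ⟨fun h => h i.2, fun h _ => h⟩)
  tfae_have 3 ↔ 2 := forall_congr' fun i =>
    leftResultant_eq_zero_iff_of_eq (hdeg i) (rightDeriv_take f a i)
  tfae_have 4 ↔ 2 := forall_congr' fun i =>
    gcld_ne_one_iff_of_eq (hdeg i) (rightDeriv_take f a i)
  tfae_finish

theorem left_multiplicity_tfae (hr : r < f.natDegree) :
    List.TFAE [
      f.IsLeftRootVia a,
      ∀ i : Fin r, (f.leftDeriv (Fin.take i i.is_le' a)).leftEval (a i) = 0,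
      ∀ i : Fin r, SkewPoly.rightResultant (f.leftDeriv (Fin.take i i.is_le' a))
        (f.leftDeriv (Fin.take (i + 1) i.is_lt a)) = 0,
      ∀ i : Fin r, SkewPoly.gcrd (f.leftDeriv (Fin.take i i.is_le' a))
        (f.leftDeriv (Fin.take (i + 1) i.is_lt a)) ≠ 1] := by
  have hdeg : ∀ i : Fin r, 1 < (f.leftDeriv (Fin.take i i.is_le' a)).natDegree := fun i => by
    have := natDegree_leftDeriv_take f a hr.le i i.is_le'
    omega
  tfae_have 1 ↔ 2 := (leftDvd_leftP_take_iff f a r le_rfl).trans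
    (forall_congr' fun i => ⟨fun h => h i.2, fun h _ => h⟩)
  tfae_have 3 ↔ 2 := forall_congr' fun i =>
    rightResultant_eq_zero_iff_of_eq (hdeg i) (leftDeriv_take f a i)
  tfae_have 4 ↔ 2 := forall_congr' fun i =>
    gcrd_ne_one_iff_of_eq (hdeg i) (leftDeriv_take f a i)
  tfae_finish

end Multiplicity

end SkewPoly

theorem theorem3p47 {F : Type u} [DivisionRing F] (σ : F ≃+* F) (δ : SkewDerivation σ)
    (f : SkewPoly δ) (r : ℕ) (hr : 0 < r) (hrf : r < f.natDegree) (a : Fin r → F) :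
    (SkewPoly.IsRightMultiplicitySeq δ a →
      List.TFAE [
        f.IsRightRootVia a,
        ∀ i : Fin r, (f.rightDeriv (Fin.take i i.is_le' a)).rightEval (a i) = 0,
        ∀ i : Fin r, SkewPoly.leftResultant (f.rightDeriv (Fin.take i i.is_le' a))
          (f.rightDeriv (Fin.take (i + 1) i.is_lt a)) = 0,
        ∀ i : Fin r, SkewPoly.gcld (f.rightDeriv (Fin.take i i.is_le' a))
          (f.rightDeriv (Fin.take (i + 1) i.is_lt a)) ≠ 1]) ∧
    (SkewPoly.IsLeftMultiplicitySeq δ a →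
      List.TFAE [
        f.IsLeftRootVia a,
        ∀ i : Fin r, (f.leftDeriv (Fin.take i i.is_le' a)).leftEval (a i) = 0,
        ∀ i : Fin r, SkewPoly.rightResultant (f.leftDeriv (Fin.take i i.is_le' a))
          (f.leftDeriv (Fin.take (i + 1) i.is_lt a)) = 0,
        ∀ i : Fin r, SkewPoly.gcrd (f.leftDeriv (Fin.take i i.is_le' a))
          (f.leftDeriv (Fin.take (i + 1) i.is_lt a)) ≠ 1]) :=
  ⟨fun _ => SkewPoly.right_multiplicity_tfae f a hrf,
    fun _ => SkewPoly.left_multiplicity_tfae f a hrf⟩
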